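/- Let $\mathbb K$ be $\mathbb R$ or $\mathbb C$, let $q,Q_1,Q_2,Q_3,Q_4$ be real numbers with $q\neq\pm1$, and let $A$ be the unital associative $\mathbb K$-algebra generated by $a$, $a^*$, $q^N$ with the relations $$a\,q^N=q\,q^N a,\qquad q^N a^*=q\,a^*q^N,\qquad aa^*-Q_1a^*a=Q_2q^{2N}+Q_3q^N+Q_4,$$ where $q^{2N}=(q^N)^2$. A braided Hopf algebra structure on $A$ consists of linear maps $\Delta:A\to A\otimes A$, $\epsilon:A\to\mathbb K$, $S:A\to A$, $\psi:A\otimes A\to A\otimes A$ such that, with $m$ the product and $\eta$ the unit map, $(A,\Delta,\epsilon)$ is a coassociative counital coalgebra, and \begin{align*} & m(\mathrm{id}\otimes S)\Delta=m(S\otimes\mathrm{id})\Delta=\eta\epsilon,\\ &\psi(m\otimes\mathrm{id})=(\mathrm{id}\otimes m)(\psi\otimes\mathrm{id})(\mathrm{id}\otimes\psi),\quad \psi(\mathrm{id}\otimes m)=(m\otimes\mathrm{id})(\mathrm{id}\otimes\psi)(\psi\otimes\mathrm{id}),\\ &(\mathrm{id}\otimes\Delta)\psi=(\psi\otimes\mathrm{id})(\mathrm{id}\otimes\psi)(\Delta\otimes\mathrm{id}),\quad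 (\Delta\otimes\mathrm{id})\psi=(\mathrm{id}\otimes\psi)(\psi\otimes\mathrm{id})(\mathrm{id}\otimes\Delta),\\ &\Delta m=(m\otimes m)(\mathrm{id}\otimes\psi\otimes\mathrm{id})(\Delta\otimes\Delta),\quad S m=m\psi(S\otimes S),\quad \Delta S=(S\otimes S)\psi\Delta,\quad \epsilon m=\epsilon\otimes\epsilon,\\ &(\psi\otimes\mathrm{id})(\mathrm{id}\otimes\psi)(\psi\otimes\mathrm{id})=(\mathrm{id}\otimes\psi)(\psi\otimes\mathrm{id})(\mathrm{id}\otimes\psi),\\ &\Delta(1)=1\otimes1,\quad \psi(1\otimes x)=x\otimes1,\quad \psi(x\otimes1)=1\otimes x\quad(x\in A). \end{align*} ($\psi$ is not required to be invertible.) Suppose that such a structure is, for some constants in $\mathbb K$, of the form \begin{align*} \Delta(q^N)&=A_1q^N\otimes q^N+A_2a\otimes a^*+A_3a^*\otimes a+A_41\otimes q^N+A_5q^N\otimes1+A_61\otimes1,\\ \Delta(a)&=B_1q^N\otimes a+B_2a\otimes q^N+B_31\otimes a+B_4a\otimes1,\\ \Delta(a^*)&=B_1a^*\otimes q^N+B_2q^N\otimes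 a^*+B_3a^*\otimes1+B_41\otimes a^*,\\ \epsilon(q^N)&=e_1,\qquad \epsilon(a)=\epsilon(a^*)=e_2,\\ S(q^N)&=k_1q^N+k_2a+k_3a^*+k_4,\\ S(a)&=m_1q^N+m_2a+m_3a^*+m_4,\qquad S(a^*)=m_1q^N+m_2a^*+m_3a+m_4,\\ \psi(q^N\otimes q^N)&=g_1q^N\otimes q^N+g_2a\otimes a^*+g_3a^*\otimes a+g_41\otimes q^N+g_5q^N\otimes1+g_61\otimes1,\\ \psi(q^N\otimes a)&=d_1a\otimes q^N+d_2q^N\otimes a+d_31\otimes a+d_4a\otimes1,\\ \psi(a^*\otimes q^N)&=d_1q^N\otimes a^*+d_2a^*\otimes q^N+d_3a^*\otimes1+d_41\otimes a^*,\\ \psi(q^N\otimes a^*)&=f_1a^*\otimes q^N+f_2q^N\otimes a^*+f_31\otimes a^*+f_4a^*\otimes1,\\ \psi(a\otimes q^N)&=f_1q^N\otimes a+f_2a\otimes q^N+f_3a\otimes1+f_41\otimes a,\\ \psi(a\otimes a)&=z_1a\otimes a,\qquad \psi(a^*\otimes a^*)=z_1a^*\otimes a^*,\\ \psi(a\otimes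 a^*)&=b_1q^N\otimes q^N+b_2a\otimes a^*+b_3a^*\otimes a+b_41\otimes q^N+b_5q^N\otimes1+b_61\otimes1,\\ \psi(a^*\otimes a)&=c_1q^N\otimes q^N+c_2a\otimes a^*+c_3a^*\otimes a+c_41\otimes q^N+c_5q^N\otimes1+c_61\otimes1. \end{align*} Then \begin{align*} &Q_4=A_1=A_6=B_1=B_2=0,\qquad A_4=A_5=B_3=B_4=1,\\ &k_2=k_3=k_4=m_1=m_3=m_4=e_1=e_2=0,\qquad m_2=-1,\\ &b_4=b_5=b_6=c_4=c_5=c_6=g_4=g_5=g_6=d_3=d_4=f_3=f_4=0; \end{align*} and, whatever the value of the deformation parameter $Q_1$, at most one of $Q_2,Q_3$ is nonzero. (The vanishing and normalisation of these constants say that $\epsilon$ vanishes on all three generators, $S(a)=-a$, $S(a^*)=-a^*$, $\Delta(a)=a\otimes1+1\otimes a$ and $\Delta(a^*)=a^*\otimes1+1\otimes a^*$.) -/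

import Mathlib

open scoped TensorProduct

/-! ### Braided Hopf algebras in algebraic form

Triple tensor products are bracketed as `A ⊗ (A ⊗ A)`; associators are inserted where needed. -/

namespace BraidedOsc

section Maps

variable {R A : Type*} [CommRing R] [Ring A] [Algebra R A]

/-- `f ⊗ id` on `A ⊗ A ⊗ A`, for `f : A ⊗ A → A ⊗ A`. -/
def onFirst (f : A ⊗[R] A →ₗ[R] A ⊗[R] A) :
    A ⊗[R] (A ⊗[R] A) →ₗ[R] A ⊗[R] (A ⊗[R] A) :=
  (TensorProduct.assoc R A A A).toLinearMap ∘ₗ f.rTensor A ∘ₗ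
    (TensorProduct.assoc R A A A).symm.toLinearMap

/-- `id ⊗ f` on `A ⊗ A ⊗ A`, for `f : A ⊗ A → A ⊗ A`. -/
def onLast (f : A ⊗[R] A →ₗ[R] A ⊗[R] A) :
    A ⊗[R] (A ⊗[R] A) →ₗ[R] A ⊗[R] (A ⊗[R] A) :=
  f.lTensor A

variable (R A) in
/-- `m ⊗ id : A ⊗ A ⊗ A → A ⊗ A`. -/
def mulFirst : A ⊗[R] (A ⊗[R] A) →ₗ[R] A ⊗[R] A :=
  (LinearMap.mul' R A).rTensor A ∘ₗ (TensorProduct.assoc R A A A).symm.toLinearMap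

variable (R A) in
/-- `id ⊗ m : A ⊗ A ⊗ A → A ⊗ A`. -/
def mulLast : A ⊗[R] (A ⊗[R] A) →ₗ[R] A ⊗[R] A :=
  (LinearMap.mul' R A).lTensor A

/-- `Δ ⊗ id : A ⊗ A → A ⊗ A ⊗ A`. -/
def comulFirst (Δ : A →ₗ[R] A ⊗[R] A) : A ⊗[R] A →ₗ[R] A ⊗[R] (A ⊗[R] A) :=
  (TensorProduct.assoc R A A A).toLinearMap ∘ₗ Δ.rTensor A

/-- `id ⊗ Δ : A ⊗ A → A ⊗ A ⊗ A`. -/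
def comulLast (Δ : A →ₗ[R] A ⊗[R] A) : A ⊗[R] A →ₗ[R] A ⊗[R] (A ⊗[R] A) :=
  Δ.lTensor A

/-- `id ⊗ ψ ⊗ id` on `(A ⊗ A) ⊗ (A ⊗ A)`. -/
def onMiddle (ψ : A ⊗[R] A →ₗ[R] A ⊗[R] A) :
    (A ⊗[R] A) ⊗[R] (A ⊗[R] A) →ₗ[R] (A ⊗[R] A) ⊗[R] (A ⊗[R] A) :=
  (TensorProduct.assoc R A A (A ⊗[R] A)).symm.toLinearMap ∘ₗ (onFirst ψ).lTensor A ∘ₗ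
    (TensorProduct.assoc R A A (A ⊗[R] A)).toLinearMap

end Maps

/-- A braided Hopf algebra structure on an algebra `A`: a coalgebra structure (coassociative
and counital), an antipode `S` and a braiding `ψ`, both linear, satisfying the braided Hopf
algebra axioms. Associativity and unitality of the product are part of `Algebra R A`.
The braiding is not required to be invertible. -/
structure BraidedHopf (R A : Type*) [CommRing R] [Ring A] [Algebra R A] extends
    Coalgebra R A where
  /-- the antipode `S` -/
  antipode : A →ₗ[R] A
  /-- the braiding `ψ` -/
  braiding : A ⊗[R] A →ₗ[R] A ⊗[R] A
  comul_one : comul (1 : A) = 1 ⊗ₜ[R] 1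
  braiding_one_left : ∀ x : A, braiding (1 ⊗ₜ[R] x) = x ⊗ₜ[R] 1
  braiding_one_right : ∀ x : A, braiding (x ⊗ₜ[R] 1) = 1 ⊗ₜ[R] x
  mul_antipode_right :
    LinearMap.mul' R A ∘ₗ antipode.lTensor A ∘ₗ comul = Algebra.linearMap R A ∘ₗ counit
  mul_antipode_left :
    LinearMap.mul' R A ∘ₗ antipode.rTensor A ∘ₗ comul = Algebra.linearMap R A ∘ₗ counit
  braiding_mul_left :
    braiding ∘ₗ mulFirst R A = mulLast R A ∘ₗ onFirst braiding ∘ₗ onLast braiding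
  braiding_mul_right :
    braiding ∘ₗ mulLast R A = mulFirst R A ∘ₗ onLast braiding ∘ₗ onFirst braiding
  comul_last_braiding :
    comulLast comul ∘ₗ braiding = onFirst braiding ∘ₗ onLast braiding ∘ₗ comulFirst comul
  comul_first_braiding :
    comulFirst comul ∘ₗ braiding = onLast braiding ∘ₗ onFirst braiding ∘ₗ comulLast comul
  comul_mul :
    comul ∘ₗ LinearMap.mul' R A =
      TensorProduct.map (LinearMap.mul' R A) (LinearMap.mul' R A) ∘ₗ onMiddle braiding ∘ₗ
        TensorProduct.map comul comul
  antipode_mul :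
    antipode ∘ₗ LinearMap.mul' R A =
      LinearMap.mul' R A ∘ₗ braiding ∘ₗ TensorProduct.map antipode antipode
  comul_antipode :
    comul ∘ₗ antipode = TensorProduct.map antipode antipode ∘ₗ braiding ∘ₗ comul
  counit_mul :
    counit ∘ₗ LinearMap.mul' R A = LinearMap.mul' R R ∘ₗ TensorProduct.map counit counit
  yang_baxter :
    onFirst braiding ∘ₗ onLast braiding ∘ₗ onFirst braiding =
      onLast braiding ∘ₗ onFirst braiding ∘ₗ onLast braiding

/-! ### The generalized oscillator algebra -/

/-- The three generators `q^N`, `a`, `a*`. -/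
inductive Gen : Type
  | qN : Gen
  | a : Gen
  | aStar : Gen

section Oscillator

variable (𝕜 : Type*) [RCLike 𝕜]

/-- The defining relations `a q^N = q q^N a`, `q^N a* = q a* q^N` and
`a a* = Q₁ a* a + Q₂ q^{2N} + Q₃ q^N + Q₄`, where `q^{2N} = (q^N)²`. -/
inductive Rel (q Q1 Q2 Q3 Q4 : ℝ) : FreeAlgebra 𝕜 Gen → FreeAlgebra 𝕜 Gen → Prop
  | a_qN : Rel q Q1 Q2 Q3 Q4
      (FreeAlgebra.ι 𝕜 Gen.a * FreeAlgebra.ι 𝕜 Gen.qN)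
      ((q : 𝕜) • (FreeAlgebra.ι 𝕜 Gen.qN * FreeAlgebra.ι 𝕜 Gen.a))
  | qN_aStar : Rel q Q1 Q2 Q3 Q4
      (FreeAlgebra.ι 𝕜 Gen.qN * FreeAlgebra.ι 𝕜 Gen.aStar)
      ((q : 𝕜) • (FreeAlgebra.ι 𝕜 Gen.aStar * FreeAlgebra.ι 𝕜 Gen.qN))
  | a_aStar : Rel q Q1 Q2 Q3 Q4
      (FreeAlgebra.ι 𝕜 Gen.a * FreeAlgebra.ι 𝕜 Gen.aStar -
        (Q1 : 𝕜) • (FreeAlgebra.ι 𝕜 Gen.aStar * FreeAlgebra.ι 𝕜 Gen.a))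
      ((Q2 : 𝕜) • FreeAlgebra.ι 𝕜 Gen.qN ^ 2 + (Q3 : 𝕜) • FreeAlgebra.ι 𝕜 Gen.qN +
        (Q4 : 𝕜) • (1 : FreeAlgebra 𝕜 Gen))

/-- The generalized oscillator algebra: the unital associative algebra over `𝕜` presented by
the generators `q^N`, `a`, `a*` and the relations `Rel`. -/
abbrev Oscillator (q Q1 Q2 Q3 Q4 : ℝ) : Type _ := RingQuot (Rel 𝕜 q Q1 Q2 Q3 Q4)

/-- The class of a generator in the oscillator algebra. -/
noncomputable def gen (q Q1 Q2 Q3 Q4 : ℝ) (x : Gen) : Oscillator 𝕜 q Q1 Q2 Q3 Q4 :=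
  RingQuot.mkAlgHom 𝕜 (Rel 𝕜 q Q1 Q2 Q3 Q4) (FreeAlgebra.ι 𝕜 x)

end Oscillator

/-! ### The linear ansatz -/

/-- The undetermined constants of the ansatz. -/
structure Coeffs (𝕜 : Type*) where
  (A1 A2 A3 A4 A5 A6 : 𝕜)
  (B1 B2 B3 B4 : 𝕜)
  (e1 e2 : 𝕜)
  (k1 k2 k3 k4 : 𝕜)
  (m1 m2 m3 m4 : 𝕜)
  (g1 g2 g3 g4 g5 g6 : 𝕜)
  (d1 d2 d3 d4 : 𝕜)
  (f1 f2 f3 f4 : 𝕜)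
  (z1 : 𝕜)
  (b1 b2 b3 b4 b5 b6 : 𝕜)
  (c1 c2 c3 c4 c5 c6 : 𝕜)

/-- The braided Hopf algebra structure `H` on an algebra with distinguished elements
`K` (for `q^N`), `a` and `s` (for `a*`) is of the form of the ansatz, with constants `c`. -/
structure HasAnsatz {𝕜 A : Type*} [CommRing 𝕜] [Ring A] [Algebra 𝕜 A]
    (H : BraidedHopf 𝕜 A) (K a s : A) (c : Coeffs 𝕜) : Prop where
  comul_qN : H.comul K =
    c.A1 • (K ⊗ₜ[𝕜] K) + c.A2 • (a ⊗ₜ[𝕜] s) + c.A3 • (s ⊗ₜ[𝕜] a) +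
      c.A4 • (1 ⊗ₜ[𝕜] K) + c.A5 • (K ⊗ₜ[𝕜] 1) + c.A6 • (1 ⊗ₜ[𝕜] 1)
  comul_a : H.comul a =
    c.B1 • (K ⊗ₜ[𝕜] a) + c.B2 • (a ⊗ₜ[𝕜] K) + c.B3 • (1 ⊗ₜ[𝕜] a) + c.B4 • (a ⊗ₜ[𝕜] 1)
  comul_aStar : H.comul s =
    c.B1 • (s ⊗ₜ[𝕜] K) + c.B2 • (K ⊗ₜ[𝕜] s) + c.B3 • (s ⊗ₜ[𝕜] 1) + c.B4 • (1 ⊗ₜ[𝕜] s)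
  counit_qN : H.counit K = c.e1
  counit_a : H.counit a = c.e2
  counit_aStar : H.counit s = c.e2
  antipode_qN : H.antipode K = c.k1 • K + c.k2 • a + c.k3 • s + c.k4 • (1 : A)
  antipode_a : H.antipode a = c.m1 • K + c.m2 • a + c.m3 • s + c.m4 • (1 : A)
  antipode_aStar : H.antipode s = c.m1 • K + c.m2 • s + c.m3 • a + c.m4 • (1 : A)
  braiding_qN_qN : H.braiding (K ⊗ₜ[𝕜] K) =
    c.g1 • (K ⊗ₜ[𝕜] K) + c.g2 • (a ⊗ₜ[𝕜] s) + c.g3 • (s ⊗ₜ[𝕜] a) +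
      c.g4 • (1 ⊗ₜ[𝕜] K) + c.g5 • (K ⊗ₜ[𝕜] 1) + c.g6 • (1 ⊗ₜ[𝕜] 1)
  braiding_qN_a : H.braiding (K ⊗ₜ[𝕜] a) =
    c.d1 • (a ⊗ₜ[𝕜] K) + c.d2 • (K ⊗ₜ[𝕜] a) + c.d3 • (1 ⊗ₜ[𝕜] a) + c.d4 • (a ⊗ₜ[𝕜] 1)
  braiding_aStar_qN : H.braiding (s ⊗ₜ[𝕜] K) =
    c.d1 • (K ⊗ₜ[𝕜] s) + c.d2 • (s ⊗ₜ[𝕜] K) + c.d3 • (s ⊗ₜ[𝕜] 1) + c.d4 • (1 ⊗ₜ[𝕜] s)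
  braiding_qN_aStar : H.braiding (K ⊗ₜ[𝕜] s) =
    c.f1 • (s ⊗ₜ[𝕜] K) + c.f2 • (K ⊗ₜ[𝕜] s) + c.f3 • (1 ⊗ₜ[𝕜] s) + c.f4 • (s ⊗ₜ[𝕜] 1)
  braiding_a_qN : H.braiding (a ⊗ₜ[𝕜] K) =
    c.f1 • (K ⊗ₜ[𝕜] a) + c.f2 • (a ⊗ₜ[𝕜] K) + c.f3 • (a ⊗ₜ[𝕜] 1) + c.f4 • (1 ⊗ₜ[𝕜] a)
  braiding_a_a : H.braiding (a ⊗ₜ[𝕜] a) = c.z1 • (a ⊗ₜ[𝕜] a)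
  braiding_aStar_aStar : H.braiding (s ⊗ₜ[𝕜] s) = c.z1 • (s ⊗ₜ[𝕜] s)
  braiding_a_aStar : H.braiding (a ⊗ₜ[𝕜] s) =
    c.b1 • (K ⊗ₜ[𝕜] K) + c.b2 • (a ⊗ₜ[𝕜] s) + c.b3 • (s ⊗ₜ[𝕜] a) +
      c.b4 • (1 ⊗ₜ[𝕜] K) + c.b5 • (K ⊗ₜ[𝕜] 1) + c.b6 • (1 ⊗ₜ[𝕜] 1)
  braiding_aStar_a : H.braiding (s ⊗ₜ[𝕜] a) =
    c.c1 • (K ⊗ₜ[𝕜] K) + c.c2 • (a ⊗ₜ[𝕜] s) + c.c3 • (s ⊗ₜ[𝕜] a) +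
      c.c4 • (1 ⊗ₜ[𝕜] K) + c.c5 • (K ⊗ₜ[𝕜] 1) + c.c6 • (1 ⊗ₜ[𝕜] 1)

end BraidedOsc

/-!
The regular representation on normally ordered monomials `(a*)ⁱ (q^N)ʲ aᵏ` shows that these are
linearly independent in the oscillator algebra, so every axiom, evaluated on generators, can be
compared coefficient by coefficient. Write `K`, `a`, `s` for `q^N`, `a`, `a*`. The resulting
polynomial equations between the constants of the ansatz are solved in three steps.

* The coalgebra axioms and the antipode at `K` and `a` give `A₁ = B₁ = B₂ = 0`, hence `a` and `s` are
  primitive and `K - e₁` is primitive up to multiples of `a ⊗ s` and `s ⊗ a`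
  (`A1_B1_B2_eq_zero`, `hasPrimitiveComul`, `antipode_constants`).
* The compatibility of `ψ` with `Δ` expresses all inhomogeneous constants of the braiding through
  `e₁` in such a way that they vanish with it (`braiding_a_aStar_constants`,
  `braiding_qN_constants`); the counit does the same for `Q₄` (`counit_relation`).
* It remains to see that `e₁ = 0`. The relation between `a` and `K` becomes inhomogeneous in terms of
  `K - e₁`, with the extra term `(q - 1) e₁ a`, and its compatibility with `ψ` and `Δ` is
  contradictory unless `e₁ = 0` (`e1_eq_zero_of_A2_ne_zero`, `e1_eq_zero_of_A2_eq_zero`).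

With `e₁ = 0`, the relation for `a s` is compatible with `ψ` only if `K²` and `K` are not both
present in it (`Q2_eq_zero_or_Q3_eq_zero`).
-/

open scoped TensorProduct

namespace BraidedOsc

/-! ### The regular representation on normally ordered monomials -/

section Representation

variable {𝕜 : Type*} [Field 𝕜]

/-- Left multiplication by `a*` in normally ordered coordinates: the basis vector `(i, j, k)` of
`ℕ × ℕ × ℕ →₀ 𝕜` stands for the monomial `(a*)ⁱ (q^N)ʲ aᵏ`. -/
noncomputable def mulAStarOp (𝕜 : Type*) [Field 𝕜] : Module.End 𝕜 (ℕ × ℕ × ℕ →₀ 𝕜) :=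
  Finsupp.linearCombination 𝕜 fun m => Finsupp.single (m.1 + 1, m.2.1, m.2.2) 1

/-- Left multiplication by `q^N`; moving it past `(a*)ⁱ` costs the factor `qⁱ`. -/
noncomputable def mulQNOp (q : 𝕜) : Module.End 𝕜 (ℕ × ℕ × ℕ →₀ 𝕜) :=
  Finsupp.linearCombination 𝕜 fun m => Finsupp.single (m.1, m.2.1 + 1, m.2.2) (q ^ m.1)

/-- The normally ordered form of `a · (a*)ⁱ (q^N)ʲ aᵏ`, obtained by moving `a` past the factors `a*`
one at a time. -/
noncomputable def mulAVec (q Q1 Q2 Q3 Q4 : 𝕜) : ℕ → ℕ → ℕ → (ℕ × ℕ × ℕ →₀ 𝕜)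
  | 0, j, k => Finsupp.single (0, j, k + 1) (q ^ j)
  | i + 1, j, k => Q1 • mulAStarOp 𝕜 (mulAVec q Q1 Q2 Q3 Q4 i j k) +
      (Finsupp.single (i, j + 2, k) (Q2 * q ^ (2 * i)) + Finsupp.single (i, j + 1, k) (Q3 * q ^ i) +
        Finsupp.single (i, j, k) Q4)

/-- Left multiplication by `a`. -/
noncomputable def mulAOp (q Q1 Q2 Q3 Q4 : 𝕜) : Module.End 𝕜 (ℕ × ℕ × ℕ →₀ 𝕜) :=
  Finsupp.linearCombination 𝕜 fun m => mulAVec q Q1 Q2 Q3 Q4 m.1 m.2.1 m.2.2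

@[simp] lemma mulAStarOp_single (i j k : ℕ) (x : 𝕜) :
    mulAStarOp 𝕜 (Finsupp.single (i, j, k) x) = Finsupp.single (i + 1, j, k) x := by
  simp [mulAStarOp]

@[simp] lemma mulQNOp_single (q : 𝕜) (i j k : ℕ) (x : 𝕜) :
    mulQNOp q (Finsupp.single (i, j, k) x) = Finsupp.single (i, j + 1, k) (x * q ^ i) := by
  simp [mulQNOp]

@[simp] lemma mulAOp_single (q Q1 Q2 Q3 Q4 : 𝕜) (i j k : ℕ) (x : 𝕜) :
    mulAOp q Q1 Q2 Q3 Q4 (Finsupp.single (i, j, k) x) = x • mulAVec q Q1 Q2 Q3 Q4 i j k := by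
  simp [mulAOp]

lemma mulQNOp_mul_mulAStarOp (q : 𝕜) :
    mulQNOp q * mulAStarOp 𝕜 = q • (mulAStarOp 𝕜 * mulQNOp q) := by
  ext ⟨i, j, k⟩ : 2
  simp [pow_succ']

/-- The relation `a q^N = q q^N a` applied to `(a*)ⁱ (q^N)ʲ aᵏ`, where `q^N` acts with the factor
`qⁱ`. -/
lemma mulAVec_succ_middle (q Q1 Q2 Q3 Q4 : 𝕜) (i j k : ℕ) :
    q ^ i • mulAVec q Q1 Q2 Q3 Q4 i (j + 1) k =
      q • mulQNOp q (mulAVec q Q1 Q2 Q3 Q4 i j k) := by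
  induction i with
  | zero => simp [mulAVec, pow_succ']
  | succ i ih =>
    have h := fun v => LinearMap.congr_fun (mulQNOp_mul_mulAStarOp q) v
    simp only [Module.End.mul_apply, LinearMap.smul_apply] at h
    have ih' := congrArg (fun v => (q * Q1) • mulAStarOp 𝕜 v) ih
    simp only [map_smul, smul_smul] at ih'
    simp only [mulAVec, map_add, map_smul, smul_add, h, smul_smul, mulQNOp_single,
      Finsupp.smul_single, smul_eq_mul]
    congr 1
    · rw [show q ^ (i + 1) * Q1 = q * Q1 * q ^ i by ring, ih']
      congr 1; ring
    · congr 1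
      · congr 1 <;> congr 1 <;> ring
      · congr 1; ring

lemma mulAOp_mul_mulQNOp (q Q1 Q2 Q3 Q4 : 𝕜) :
    mulAOp q Q1 Q2 Q3 Q4 * mulQNOp q = q • (mulQNOp q * mulAOp q Q1 Q2 Q3 Q4) := by
  ext ⟨i, j, k⟩ : 2
  simp [mulAVec_succ_middle]

lemma mulAOp_mul_mulAStarOp (q Q1 Q2 Q3 Q4 : 𝕜) :
    mulAOp q Q1 Q2 Q3 Q4 * mulAStarOp 𝕜 - Q1 • (mulAStarOp 𝕜 * mulAOp q Q1 Q2 Q3 Q4) =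
      Q2 • mulQNOp q ^ 2 + Q3 • mulQNOp q + Q4 • 1 := by
  ext ⟨i, j, k⟩ : 2
  simp [mulAVec, pow_two, two_mul, pow_add, Finsupp.smul_single, -Finsupp.single_mul]

end Representation

/-- `K`, `a`, `s` satisfy the relations of the oscillator algebra for `q^N`, `a`, `a*`, and the linear
map `φ` sends the monomials `sⁱ Kʲ aᵏ` with `i + j + k ≤ 2` to the corresponding basis vectors. The
scalars `q`, `Q₁`, …, `Q₄` are taken in `𝕜`. -/
structure IsCoordinateMap {𝕜 A : Type*} [Field 𝕜] [Ring A] [Algebra 𝕜 A] (q Q1 Q2 Q3 Q4 : 𝕜)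
    (K a s : A) (φ : A →ₗ[𝕜] (ℕ × ℕ × ℕ →₀ 𝕜)) : Prop where
  a_mul_K : a * K = q • (K * a)
  K_mul_s : K * s = q • (s * K)
  a_mul_s : a * s = Q1 • (s * a) + Q2 • (K * K) + Q3 • K + Q4 • (1 : A)
  coord_one : φ 1 = Finsupp.single (0, 0, 0) 1
  coord_K : φ K = Finsupp.single (0, 1, 0) 1
  coord_a : φ a = Finsupp.single (0, 0, 1) 1
  coord_s : φ s = Finsupp.single (1, 0, 0) 1
  coord_K_mul_K : φ (K * K) = Finsupp.single (0, 2, 0) 1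
  coord_K_mul_a : φ (K * a) = Finsupp.single (0, 1, 1) 1
  coord_a_mul_a : φ (a * a) = Finsupp.single (0, 0, 2) 1
  coord_s_mul_s : φ (s * s) = Finsupp.single (2, 0, 0) 1
  coord_s_mul_K : φ (s * K) = Finsupp.single (1, 1, 0) 1
  coord_s_mul_a : φ (s * a) = Finsupp.single (1, 0, 1) 1

section Oscillator

variable (𝕜 : Type*) [RCLike 𝕜]

/-- The representation of the oscillator algebra by the left multiplication operators. -/
noncomputable def regRep (q Q1 Q2 Q3 Q4 : ℝ) :
    Oscillator 𝕜 q Q1 Q2 Q3 Q4 →ₐ[𝕜] Module.End 𝕜 (ℕ × ℕ × ℕ →₀ 𝕜) :=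
  RingQuot.liftAlgHom 𝕜 ⟨FreeAlgebra.lift 𝕜 fun
      | Gen.qN => mulQNOp (q : 𝕜)
      | Gen.a => mulAOp (q : 𝕜) Q1 Q2 Q3 Q4
      | Gen.aStar => mulAStarOp 𝕜, by
    intro x y h
    cases h with
    | a_qN =>
      simpa only [map_mul, map_smul, FreeAlgebra.lift_ι_apply] using
        mulAOp_mul_mulQNOp (q : 𝕜) Q1 Q2 Q3 Q4
    | qN_aStar =>
      simpa only [map_mul, map_smul, FreeAlgebra.lift_ι_apply] using
        mulQNOp_mul_mulAStarOp (q : 𝕜)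
    | a_aStar =>
      simpa only [map_mul, map_smul, map_sub, map_add, map_pow, map_one,
        FreeAlgebra.lift_ι_apply] using mulAOp_mul_mulAStarOp (q : 𝕜) Q1 Q2 Q3 Q4⟩

lemma regRep_gen (q Q1 Q2 Q3 Q4 : ℝ) (x : Gen) :
    regRep 𝕜 q Q1 Q2 Q3 Q4 (gen 𝕜 q Q1 Q2 Q3 Q4 x) = match x with
      | Gen.qN => mulQNOp (q : 𝕜)
      | Gen.a => mulAOp (q : 𝕜) Q1 Q2 Q3 Q4
      | Gen.aStar => mulAStarOp 𝕜 := by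
  simp [regRep, gen]

/-- Acting on the vector of the monomial `1` in the regular representation reads off normally ordered
coordinates, so the ordered monomials are linearly independent. -/
lemma exists_isCoordinateMap (q Q1 Q2 Q3 Q4 : ℝ) :
    ∃ φ, IsCoordinateMap (q : 𝕜) Q1 Q2 Q3 Q4 (gen 𝕜 q Q1 Q2 Q3 Q4 Gen.qN) (gen 𝕜 q Q1 Q2 Q3 Q4 Gen.a)
      (gen 𝕜 q Q1 Q2 Q3 Q4 Gen.aStar) φ := by
  refine ⟨LinearMap.applyₗ (Finsupp.single (0, 0, 0) 1) ∘ₗ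
    (regRep 𝕜 q Q1 Q2 Q3 Q4).toLinearMap, ?_⟩
  constructor
  · simpa only [gen, map_mul, map_smul] using
      RingQuot.mkAlgHom_rel 𝕜 (s := Rel 𝕜 q Q1 Q2 Q3 Q4) (Rel.a_qN)
  · simpa only [gen, map_mul, map_smul] using
      RingQuot.mkAlgHom_rel 𝕜 (s := Rel 𝕜 q Q1 Q2 Q3 Q4) (Rel.qN_aStar)
  · have := RingQuot.mkAlgHom_rel 𝕜 (s := Rel 𝕜 q Q1 Q2 Q3 Q4) (Rel.a_aStar)
    simp only [map_sub, map_add, map_mul, map_smul, map_one, sub_eq_iff_eq_add, pow_two] at this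
    simp only [gen, this]
    abel
  all_goals simp [regRep_gen, mulAVec]

end Oscillator

/-! ### Coefficient functionals and the structure maps on pure tensors -/

section Functionals

variable {𝕜 A : Type*} [Field 𝕜] [Ring A] [Algebra 𝕜 A]

/-- The coefficient of `(a*)ⁱ (q^N)ʲ aᵏ`. -/
noncomputable def coeff (φ : A →ₗ[𝕜] (ℕ × ℕ × ℕ →₀ 𝕜)) (i j k : ℕ) : A →ₗ[𝕜] 𝕜 :=
  Finsupp.lapply (i, j, k) ∘ₗ φ

/-- The functional `f ⊗ g` on a tensor product. -/
noncomputable def pairing {V W : Type*} [AddCommGroup V] [Module 𝕜 V] [AddCommGroup W] [Module 𝕜 W]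
    (f : V →ₗ[𝕜] 𝕜) (g : W →ₗ[𝕜] 𝕜) : V ⊗[𝕜] W →ₗ[𝕜] 𝕜 :=
  LinearMap.mul' 𝕜 𝕜 ∘ₗ TensorProduct.map f g

lemma pairing_tmul {V W : Type*} [AddCommGroup V] [Module 𝕜 V] [AddCommGroup W] [Module 𝕜 W]
    (f : V →ₗ[𝕜] 𝕜) (g : W →ₗ[𝕜] 𝕜) (v : V) (w : W) :
    pairing f g (v ⊗ₜ w) = f v * g w := by
  simp [pairing]

lemma onFirst_tmul (f : A ⊗[𝕜] A →ₗ[𝕜] A ⊗[𝕜] A) (x y z : A) :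
    onFirst f (x ⊗ₜ (y ⊗ₜ z)) = TensorProduct.assoc 𝕜 A A A (f (x ⊗ₜ y) ⊗ₜ z) := by
  simp [onFirst]

lemma onLast_tmul (f : A ⊗[𝕜] A →ₗ[𝕜] A ⊗[𝕜] A) (x : A) (u : A ⊗[𝕜] A) :
    onLast f (x ⊗ₜ u) = x ⊗ₜ f u := by
  simp [onLast]

lemma mulFirst_tmul (x y z : A) : mulFirst 𝕜 A (x ⊗ₜ (y ⊗ₜ z)) = (x * y) ⊗ₜ z := by
  simp [mulFirst]

lemma mulLast_tmul (x y z : A) : mulLast 𝕜 A (x ⊗ₜ (y ⊗ₜ z)) = x ⊗ₜ (y * z) := by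
  simp [mulLast]

lemma comulFirst_tmul (Δ : A →ₗ[𝕜] A ⊗[𝕜] A) (x y : A) :
    comulFirst Δ (x ⊗ₜ y) = TensorProduct.assoc 𝕜 A A A (Δ x ⊗ₜ y) := by
  simp [comulFirst]

lemma comulLast_tmul (Δ : A →ₗ[𝕜] A ⊗[𝕜] A) (x y : A) :
    comulLast Δ (x ⊗ₜ y) = x ⊗ₜ Δ y := by
  simp [comulLast]

lemma onMiddle_tmul (f : A ⊗[𝕜] A →ₗ[𝕜] A ⊗[𝕜] A) (x y z w : A) :
    onMiddle f ((x ⊗ₜ y) ⊗ₜ (z ⊗ₜ w)) = (TensorProduct.assoc 𝕜 A A (A ⊗[𝕜] A)).symm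
      (x ⊗ₜ TensorProduct.assoc 𝕜 A A A (f (y ⊗ₜ z) ⊗ₜ w)) := by
  simp [onMiddle, onFirst]

variable (H : BraidedHopf 𝕜 A)

lemma BraidedHopf.braiding_mul_tmul (x y z : A) :
    H.braiding ((x * y) ⊗ₜ z) = mulLast 𝕜 A (onFirst H.braiding (x ⊗ₜ H.braiding (y ⊗ₜ z))) := by
  have h := LinearMap.congr_fun H.braiding_mul_left (x ⊗ₜ (y ⊗ₜ z))
  simpa only [LinearMap.comp_apply, mulFirst_tmul, onLast_tmul] using h

lemma BraidedHopf.braiding_tmul_mul (x y z : A) :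
    H.braiding (x ⊗ₜ (y * z)) = mulFirst 𝕜 A (onLast H.braiding
      (TensorProduct.assoc 𝕜 A A A (H.braiding (x ⊗ₜ y) ⊗ₜ z))) := by
  have h := LinearMap.congr_fun H.braiding_mul_right (x ⊗ₜ (y ⊗ₜ z))
  simpa only [LinearMap.comp_apply, mulLast_tmul, onFirst_tmul] using h

end Functionals

section Rules

variable {𝕜 A : Type*} [Field 𝕜] [Ring A] [Algebra 𝕜 A] {q Q1 Q2 Q3 Q4 : 𝕜} {K a s : A}
  {φ : A →ₗ[𝕜] (ℕ × ℕ × ℕ →₀ 𝕜)} {H : BraidedHopf 𝕜 A} {c : Coeffs 𝕜}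

/-- The defining relations as rewriting rules towards normal order. -/
lemma IsCoordinateMap.mul_rules (hF : IsCoordinateMap q Q1 Q2 Q3 Q4 K a s φ) :
    a * K = q • (K * a) ∧ K * s = q • (s * K) ∧
      a * s = Q1 • (s * a) + Q2 • (K * K) + Q3 • K + Q4 • (1 : A) :=
  ⟨hF.a_mul_K, hF.K_mul_s, hF.a_mul_s⟩

lemma IsCoordinateMap.coeff_rules (hF : IsCoordinateMap q Q1 Q2 Q3 Q4 K a s φ) :
    (∀ i j k, coeff φ i j k 1 = if 0 = i ∧ 0 = j ∧ 0 = k then 1 else 0) ∧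
    (∀ i j k, coeff φ i j k K = if 0 = i ∧ 1 = j ∧ 0 = k then 1 else 0) ∧
    (∀ i j k, coeff φ i j k a = if 0 = i ∧ 0 = j ∧ 1 = k then 1 else 0) ∧
    (∀ i j k, coeff φ i j k s = if 1 = i ∧ 0 = j ∧ 0 = k then 1 else 0) ∧
    (∀ i j k, coeff φ i j k (K * K) = if 0 = i ∧ 2 = j ∧ 0 = k then 1 else 0) ∧
    (∀ i j k, coeff φ i j k (K * a) = if 0 = i ∧ 1 = j ∧ 1 = k then 1 else 0) ∧
    (∀ i j k, coeff φ i j k (a * a) = if 0 = i ∧ 0 = j ∧ 2 = k then 1 else 0) ∧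
    (∀ i j k, coeff φ i j k (s * s) = if 2 = i ∧ 0 = j ∧ 0 = k then 1 else 0) ∧
    (∀ i j k, coeff φ i j k (s * K) = if 1 = i ∧ 1 = j ∧ 0 = k then 1 else 0) ∧
    (∀ i j k, coeff φ i j k (s * a) = if 1 = i ∧ 0 = j ∧ 1 = k then 1 else 0) := by
  simp only [coeff, LinearMap.comp_apply, Finsupp.lapply_apply, hF.coord_one, hF.coord_K,
    hF.coord_a, hF.coord_s, hF.coord_K_mul_K, hF.coord_K_mul_a, hF.coord_a_mul_a,
    hF.coord_s_mul_s, hF.coord_s_mul_K, hF.coord_s_mul_a, Finsupp.single_apply, Prod.mk.injEq,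
    implies_true, and_self]

/-- The values of `ψ` on the generators and `1`, bundled for rewriting. -/
lemma HasAnsatz.braiding_rules (hc : HasAnsatz H K a s c) :
    (∀ x : A, H.braiding (1 ⊗ₜ[𝕜] x) = x ⊗ₜ[𝕜] 1) ∧
    (∀ x : A, H.braiding (x ⊗ₜ[𝕜] 1) = 1 ⊗ₜ[𝕜] x) ∧
    (H.braiding (K ⊗ₜ[𝕜] K) =
        c.g1 • (K ⊗ₜ[𝕜] K) + c.g2 • (a ⊗ₜ[𝕜] s) + c.g3 • (s ⊗ₜ[𝕜] a) +
        c.g4 • (1 ⊗ₜ[𝕜] K) + c.g5 • (K ⊗ₜ[𝕜] 1) + c.g6 • (1 ⊗ₜ[𝕜] 1)) ∧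
    (H.braiding (K ⊗ₜ[𝕜] a) =
        c.d1 • (a ⊗ₜ[𝕜] K) + c.d2 • (K ⊗ₜ[𝕜] a) + c.d3 • (1 ⊗ₜ[𝕜] a) + c.d4 • (a ⊗ₜ[𝕜] 1)) ∧
    (H.braiding (s ⊗ₜ[𝕜] K) =
        c.d1 • (K ⊗ₜ[𝕜] s) + c.d2 • (s ⊗ₜ[𝕜] K) + c.d3 • (s ⊗ₜ[𝕜] 1) + c.d4 • (1 ⊗ₜ[𝕜] s)) ∧
    (H.braiding (K ⊗ₜ[𝕜] s) =
        c.f1 • (s ⊗ₜ[𝕜] K) + c.f2 • (K ⊗ₜ[𝕜] s) + c.f3 • (1 ⊗ₜ[𝕜] s) + c.f4 • (s ⊗ₜ[𝕜] 1)) ∧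
    (H.braiding (a ⊗ₜ[𝕜] K) =
        c.f1 • (K ⊗ₜ[𝕜] a) + c.f2 • (a ⊗ₜ[𝕜] K) + c.f3 • (a ⊗ₜ[𝕜] 1) + c.f4 • (1 ⊗ₜ[𝕜] a)) ∧
    (H.braiding (a ⊗ₜ[𝕜] a) = c.z1 • (a ⊗ₜ[𝕜] a)) ∧
    (H.braiding (s ⊗ₜ[𝕜] s) = c.z1 • (s ⊗ₜ[𝕜] s)) ∧
    (H.braiding (a ⊗ₜ[𝕜] s) =
        c.b1 • (K ⊗ₜ[𝕜] K) + c.b2 • (a ⊗ₜ[𝕜] s) + c.b3 • (s ⊗ₜ[𝕜] a) +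
        c.b4 • (1 ⊗ₜ[𝕜] K) + c.b5 • (K ⊗ₜ[𝕜] 1) + c.b6 • (1 ⊗ₜ[𝕜] 1)) ∧
    (H.braiding (s ⊗ₜ[𝕜] a) =
        c.c1 • (K ⊗ₜ[𝕜] K) + c.c2 • (a ⊗ₜ[𝕜] s) + c.c3 • (s ⊗ₜ[𝕜] a) +
        c.c4 • (1 ⊗ₜ[𝕜] K) + c.c5 • (K ⊗ₜ[𝕜] 1) + c.c6 • (1 ⊗ₜ[𝕜] 1)) :=
  ⟨H.braiding_one_left, H.braiding_one_right, hc.braiding_qN_qN, hc.braiding_qN_a,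
    hc.braiding_aStar_qN, hc.braiding_qN_aStar, hc.braiding_a_qN, hc.braiding_a_a,
    hc.braiding_aStar_aStar, hc.braiding_a_aStar, hc.braiding_aStar_a⟩

/-- The values of `Δ` on the generators and `1`, bundled for rewriting. -/
lemma HasAnsatz.comul_rules (hc : HasAnsatz H K a s c) :
    H.comul (1 : A) = 1 ⊗ₜ[𝕜] 1 ∧
    (H.comul K =
        c.A1 • (K ⊗ₜ[𝕜] K) + c.A2 • (a ⊗ₜ[𝕜] s) + c.A3 • (s ⊗ₜ[𝕜] a) +
        c.A4 • (1 ⊗ₜ[𝕜] K) + c.A5 • (K ⊗ₜ[𝕜] 1) + c.A6 • (1 ⊗ₜ[𝕜] 1)) ∧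
    (H.comul a =
        c.B1 • (K ⊗ₜ[𝕜] a) + c.B2 • (a ⊗ₜ[𝕜] K) + c.B3 • (1 ⊗ₜ[𝕜] a) + c.B4 • (a ⊗ₜ[𝕜] 1)) ∧
    (H.comul s =
        c.B1 • (s ⊗ₜ[𝕜] K) + c.B2 • (K ⊗ₜ[𝕜] s) + c.B3 • (s ⊗ₜ[𝕜] 1) + c.B4 • (1 ⊗ₜ[𝕜] s)) :=
  ⟨H.comul_one, hc.comul_qN, hc.comul_a, hc.comul_aStar⟩

end Rules

/-! ### Coefficients of the braided Hopf algebra axioms on generators -/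

section CoefficientEquations

variable {𝕜 A : Type*} [Field 𝕜] [Ring A] [Algebra 𝕜 A] {q Q1 Q2 Q3 Q4 : 𝕜} {K a s : A}
  {φ : A →ₗ[𝕜] (ℕ × ℕ × ℕ →₀ 𝕜)} {H : BraidedHopf 𝕜 A} {c : Coeffs 𝕜}

lemma BraidedHopf.comul_mul_apply (x y : A) :
    H.comul (x * y) = TensorProduct.map (LinearMap.mul' 𝕜 A) (LinearMap.mul' 𝕜 A)
      (onMiddle H.braiding (H.comul x ⊗ₜ H.comul y)) := by
  simpa using LinearMap.congr_fun H.comul_mul (x ⊗ₜ y)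

lemma BraidedHopf.counit_mul_apply (x y : A) :
    H.counit (x * y) = H.counit x * H.counit y := by
  simpa using LinearMap.congr_fun H.counit_mul (x ⊗ₜ y)

lemma counit_one (hF : IsCoordinateMap q Q1 Q2 Q3 Q4 K a s φ) : H.counit (1 : A) = 1 := by
  have h := congrArg (pairing LinearMap.id (coeff φ 0 0 0))
    (LinearMap.congr_fun H.rTensor_counit_comp_comul (1 : A))
  simpa [H.comul_one, pairing_tmul, hF.coeff_rules] using h

lemma antipode_one (hF : IsCoordinateMap q Q1 Q2 Q3 Q4 K a s φ) : H.antipode (1 : A) = 1 := by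
  simpa [H.comul_one, counit_one hF] using LinearMap.congr_fun H.mul_antipode_right (1 : A)

/-- Coefficients of the two counit axioms at `K`, and of the two counit axioms at `a`. -/
lemma counit_comul
    (hF : IsCoordinateMap q Q1 Q2 Q3 Q4 K a s φ) (hc : HasAnsatz H K a s c) :
    (c.A1 * c.e1 + c.A4 - 1 = 0 ∧
     c.A5 * c.e1 + c.A6 = 0) ∧
    (c.A1 * c.e1 + c.A5 - 1 = 0 ∧
     c.A4 * c.e1 + c.A6 = 0) ∧
    c.B1 * c.e1 + c.B3 - 1 = 0 ∧
    (c.B1 * c.e2 = 0 ∧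
     c.B2 * c.e1 + c.B4 - 1 = 0 ∧
     c.B3 * c.e2 = 0) := by
  have left_K (f : A →ₗ[𝕜] 𝕜) :=
    congrArg (pairing LinearMap.id f) (LinearMap.congr_fun H.rTensor_counit_comp_comul K)
  have right_K (f : A →ₗ[𝕜] 𝕜) :=
    congrArg (pairing f LinearMap.id) (LinearMap.congr_fun H.lTensor_counit_comp_comul K)
  have left_a (f : A →ₗ[𝕜] 𝕜) :=
    congrArg (pairing LinearMap.id f) (LinearMap.congr_fun H.rTensor_counit_comp_comul a)
  have right_a (f : A →ₗ[𝕜] 𝕜) :=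
    congrArg (pairing f LinearMap.id) (LinearMap.congr_fun H.lTensor_counit_comp_comul a)
  simp only [LinearMap.comp_apply, hc.comul_rules, map_add, map_smul, LinearMap.rTensor_tmul,
    LinearMap.lTensor_tmul, TensorProduct.mk_apply, LinearMap.flip_apply, LinearMap.id_apply,
    hc.counit_qN, hc.counit_a, hc.counit_aStar, counit_one hF, pairing_tmul, smul_eq_mul, one_mul,
    mul_one] at left_K right_K left_a right_a
  have e1 := left_K (coeff φ 0 1 0)
  have e2 := left_K (coeff φ 0 0 0)
  have e3 := right_K (coeff φ 0 1 0)
  have e4 := right_K (coeff φ 0 0 0)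
  have e5 := left_a (coeff φ 0 0 1)
  have e6 := right_a (coeff φ 0 1 0)
  have e7 := right_a (coeff φ 0 0 1)
  have e8 := right_a (coeff φ 0 0 0)
  simp +decide only [hF.coeff_rules, reduceIte] at e1 e2 e3 e4 e5 e6 e7 e8
  exact ⟨⟨by linear_combination e1, by linear_combination e2⟩, ⟨by linear_combination e3, by
    linear_combination e4⟩, by linear_combination e5, ⟨by linear_combination e6, by
    linear_combination e7, by linear_combination e8⟩⟩

/-- Coefficients of coassociativity at `K` and at `a`. -/
lemma coassoc_coeff
    (hF : IsCoordinateMap q Q1 Q2 Q3 Q4 K a s φ) (hc : HasAnsatz H K a s c) :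
    (c.A1 * c.A2 - c.A2 * c.B1 = 0 ∧
     c.A1 * c.A3 - c.A3 * c.B2 = 0) ∧
    (c.A1 * c.B1 - c.B1 ^ 2 = 0 ∧
     c.A2 * c.B1 - c.A3 * c.B2 = 0 ∧
     -c.A2 * c.B2 = 0 ∧
     -c.A1 * c.B2 + c.B2 ^ 2 = 0) := by
  have coassoc_K (f g h : A →ₗ[𝕜] 𝕜) :=
    congrArg (pairing f (pairing g h)) (LinearMap.congr_fun H.coassoc K)
  have coassoc_a (f g h : A →ₗ[𝕜] 𝕜) :=
    congrArg (pairing f (pairing g h)) (LinearMap.congr_fun H.coassoc a)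
  simp only [LinearMap.comp_apply, LinearEquiv.coe_coe, hc.comul_rules, TensorProduct.add_tmul,
    TensorProduct.tmul_add, ← TensorProduct.smul_tmul', TensorProduct.tmul_smul, map_add,
    map_smul, LinearMap.rTensor_tmul, LinearMap.lTensor_tmul, TensorProduct.assoc_tmul,
    pairing_tmul, smul_eq_mul] at coassoc_K coassoc_a
  have e1 := coassoc_K (coeff φ 0 0 1) (coeff φ 1 0 0) (coeff φ 0 1 0)
  have e2 := coassoc_K (coeff φ 1 0 0) (coeff φ 0 0 1) (coeff φ 0 1 0)
  have e3 := coassoc_a (coeff φ 0 1 0) (coeff φ 0 1 0) (coeff φ 0 0 1)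
  have e4 := coassoc_a (coeff φ 0 0 1) (coeff φ 1 0 0) (coeff φ 0 0 1)
  have e5 := coassoc_a (coeff φ 0 0 1) (coeff φ 0 0 1) (coeff φ 1 0 0)
  have e6 := coassoc_a (coeff φ 0 0 1) (coeff φ 0 1 0) (coeff φ 0 1 0)
  simp +decide only [hF.coeff_rules, reduceIte] at e1 e2 e3 e4 e5 e6
  exact ⟨⟨by linear_combination e1, by linear_combination e2⟩, ⟨by linear_combination e3, by
    linear_combination e4, by linear_combination e5, by linear_combination e6⟩⟩

/-- Coefficients of `m(id ⊗ S)Δ = ηε` at `K` and at `a`. -/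
lemma mul_antipode_coeff
    (hF : IsCoordinateMap q Q1 Q2 Q3 Q4 K a s φ) (hc : HasAnsatz H K a s c) :
    (c.A2 * Q3 * c.m2 + c.A1 * c.k4 + c.A4 * c.k1 + c.A5 = 0 ∧
     c.A2 * Q1 * c.m2 + c.A3 * c.m2 = 0 ∧
     c.A2 * Q2 * c.m2 + c.A1 * c.k1 = 0 ∧
     c.A2 * Q4 * c.m2 + c.A4 * c.k4 + c.A6 - c.e1 = 0 ∧
     c.A3 * c.m4 + c.A4 * c.k3 = 0 ∧
     c.A2 * c.m4 + c.A4 * c.k2 = 0) ∧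
    (c.B2 * Q3 * c.k3 + c.B1 * c.m4 + c.B3 * c.m1 = 0 ∧
     c.B3 * c.m3 = 0 ∧
     c.B2 * c.k4 + c.B3 * c.m2 + c.B4 = 0 ∧
     c.B2 * Q4 * c.k3 + c.B3 * c.m4 - c.e2 = 0) := by
  have antipode_K (f : A →ₗ[𝕜] 𝕜) := congrArg f (LinearMap.congr_fun H.mul_antipode_right K)
  have antipode_a (f : A →ₗ[𝕜] 𝕜) := congrArg f (LinearMap.congr_fun H.mul_antipode_right a)
  simp only [LinearMap.comp_apply, hc.comul_rules, map_add, map_smul, LinearMap.lTensor_tmul,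
    LinearMap.mul'_apply, hc.antipode_qN, hc.antipode_a, hc.antipode_aStar, antipode_one hF,
    hc.counit_qN, hc.counit_a, Algebra.linearMap_apply, Algebra.algebraMap_eq_smul_one, mul_add,
    mul_smul_comm, smul_eq_mul, one_mul, mul_one] at antipode_K antipode_a
  simp only [hF.mul_rules, map_add, map_smul, smul_eq_mul] at antipode_K antipode_a
  have e1 := antipode_K (coeff φ 0 1 0)
  have e2 := antipode_K (coeff φ 1 0 1)
  have e3 := antipode_K (coeff φ 0 2 0)
  have e4 := antipode_K (coeff φ 0 0 0)
  have e5 := antipode_K (coeff φ 1 0 0)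
  have e6 := antipode_K (coeff φ 0 0 1)
  have e7 := antipode_a (coeff φ 0 1 0)
  have e8 := antipode_a (coeff φ 1 0 0)
  have e9 := antipode_a (coeff φ 0 0 1)
  have e10 := antipode_a (coeff φ 0 0 0)
  simp +decide only [hF.coeff_rules, reduceIte] at e1 e2 e3 e4 e5 e6 e7 e8 e9 e10
  exact ⟨⟨by linear_combination e1, by linear_combination e2, by linear_combination e3, by
    linear_combination e4, by linear_combination e5, by linear_combination e6⟩, ⟨by
    linear_combination e7, by linear_combination e8, by linear_combination e9, by
    linear_combination e10⟩⟩

/-- Coefficients of `ψ(aK ⊗ x) = q ψ(Ka ⊗ x)` and of `ψ(x ⊗ aK) = q ψ(x ⊗ Ka)`, for `x` equal to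
`a`, `s` and `K` in this order. -/
lemma braiding_a_qN_relation
    (hF : IsCoordinateMap q Q1 Q2 Q3 Q4 K a s φ) (hc : HasAnsatz H K a s c) :
    (-c.d4 * q * c.z1 + c.d2 * c.f3 + c.d4 * c.z1 = 0 ∧
     -c.d2 * q * c.z1 + c.d2 * c.f1 = 0 ∧
     c.d2 * c.f2 = 0) ∧
    (-c.d3 * c.f2 * q - c.f4 * q * c.z1 + c.f4 * c.z1 = 0 ∧
     -c.d1 * c.f2 * q + c.f2 * c.z1 = 0) ∧
    (-c.b3 * c.f4 * q - c.b5 * c.g3 * q + c.b3 * c.f4 = 0 ∧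
     -Q1 * c.b2 * c.d2 * q + Q1 * c.f1 * c.f2 - c.b3 * c.f2 * q = 0 ∧
     -Q2 * c.b2 * c.d2 * q + Q2 * c.f1 * c.f2 - c.b1 * c.g1 * q + c.b1 * c.f1 = 0 ∧
     -c.b2 * c.d1 * q ^ 2 - c.b1 * c.g2 * q + c.f2 ^ 2 * q + c.b2 * c.f1 = 0 ∧
     -c.b2 * c.d4 * q - c.b5 * c.g2 * q + c.b2 * c.f4 + c.f2 * c.f3 = 0) ∧
    (-c.c2 * c.d4 * q + c.c2 * c.d4 + c.c4 * c.g2 = 0 ∧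
     c.c1 * c.g2 = 0) ∧
    (-c.d2 * c.f3 * q - c.f1 * c.g5 * q + c.b5 * c.g3 + c.f1 * c.g5 = 0 ∧
     -c.d2 * c.f2 * q ^ 2 + c.b1 * c.g3 = 0 ∧
     Q3 * c.g2 * c.z1 - c.d1 * c.f3 * q - c.d4 * c.f2 * q + c.f2 * c.g5 + c.f3 * c.g1 = 0) ∧
    (-c.c4 * c.g2 * q - c.d1 * c.g4 * q + c.d1 * c.g4 + c.d3 * c.f2 = 0 ∧
     -c.c2 * c.g2 * q + c.d1 * c.g2 = 0) := by
  have left_a (f g : A →ₗ[𝕜] 𝕜) := congrArg (fun x => pairing f g (H.braiding (x ⊗ₜ a))) hF.a_mul_K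
  have right_a (f g : A →ₗ[𝕜] 𝕜) := congrArg (fun x => pairing f g (H.braiding (a ⊗ₜ x))) hF.a_mul_K
  have left_s (f g : A →ₗ[𝕜] 𝕜) := congrArg (fun x => pairing f g (H.braiding (x ⊗ₜ s))) hF.a_mul_K
  have right_s (f g : A →ₗ[𝕜] 𝕜) := congrArg (fun x => pairing f g (H.braiding (s ⊗ₜ x))) hF.a_mul_K
  have left_K (f g : A →ₗ[𝕜] 𝕜) := congrArg (fun x => pairing f g (H.braiding (x ⊗ₜ K))) hF.a_mul_K
  have right_K (f g : A →ₗ[𝕜] 𝕜) := congrArg (fun x => pairing f g (H.braiding (K ⊗ₜ x))) hF.a_mul_K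
  simp only [TensorProduct.add_tmul, TensorProduct.tmul_add, ← TensorProduct.smul_tmul',
    TensorProduct.tmul_smul, map_add, map_smul, H.braiding_mul_tmul, H.braiding_tmul_mul,
    hc.braiding_rules, onFirst_tmul, onLast_tmul, mulFirst_tmul, mulLast_tmul,
    TensorProduct.assoc_tmul, pairing_tmul, smul_eq_mul, one_mul, mul_one]
    at left_a right_a left_s right_s left_K right_K
  simp only [hF.mul_rules, map_add, map_smul, smul_eq_mul]
    at left_a right_a left_s right_s left_K right_K
  have e1 := left_a (coeff φ 0 0 1) (coeff φ 0 0 1)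
  have e2 := left_a (coeff φ 0 1 0) (coeff φ 0 0 2)
  have e3 := left_a (coeff φ 0 0 1) (coeff φ 0 1 1)
  have e4 := right_a (coeff φ 0 0 1) (coeff φ 0 0 1)
  have e5 := right_a (coeff φ 0 0 2) (coeff φ 0 1 0)
  have e6 := left_s (coeff φ 1 0 0) (coeff φ 0 0 1)
  have e7 := left_s (coeff φ 0 1 0) (coeff φ 1 0 1)
  have e8 := left_s (coeff φ 0 1 0) (coeff φ 0 2 0)
  have e9 := left_s (coeff φ 0 0 1) (coeff φ 1 1 0)
  have e10 := left_s (coeff φ 0 0 1) (coeff φ 1 0 0)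
  have e11 := right_s (coeff φ 0 0 1) (coeff φ 1 0 0)
  have e12 := right_s (coeff φ 0 1 1) (coeff φ 1 0 0)
  have e13 := left_K (coeff φ 0 1 0) (coeff φ 0 0 1)
  have e14 := left_K (coeff φ 0 1 0) (coeff φ 0 1 1)
  have e15 := left_K (coeff φ 0 0 1) (coeff φ 0 1 0)
  have e16 := right_K (coeff φ 0 0 1) (coeff φ 0 1 0)
  have e17 := right_K (coeff φ 0 0 2) (coeff φ 1 0 0)
  simp +decide only [hF.coeff_rules, reduceIte]
    at e1 e2 e3 e4 e5 e6 e7 e8 e9 e10 e11 e12 e13 e14 e15 e16 e17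
  exact ⟨⟨by linear_combination e1, by linear_combination e2, by linear_combination e3⟩, ⟨by
    linear_combination e4, by linear_combination e5⟩, ⟨by linear_combination e6, by
    linear_combination e7, by linear_combination e8, by linear_combination e9, by
    linear_combination e10⟩, ⟨by linear_combination e11, by linear_combination e12⟩, ⟨by
    linear_combination e13, by linear_combination e14, by linear_combination e15⟩, ⟨by
    linear_combination e16, by linear_combination e17⟩⟩

/-- Coefficients of `ψ(as ⊗ a)`, `ψ(a ⊗ as)` and `ψ(as ⊗ K)`, each computed in two ways by means
of the relation for `as`. -/
lemma braiding_a_aStar_relation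
    (hF : IsCoordinateMap q Q1 Q2 Q3 Q4 K a s φ) (hc : HasAnsatz H K a s c) :
    (-Q2 * c.d2 * c.g2 + c.b2 * c.c3 = 0 ∧
     Q2 * c.c2 * c.z1 - Q2 * c.d1 ^ 2 + c.c1 * c.f2 = 0 ∧
     -2 * Q2 * c.d1 * c.d4 + Q3 * c.c2 * c.z1 - Q3 * c.d1 + c.c1 * c.f3 + c.c5 * c.f2 = 0 ∧
     -Q1 * c.c5 * c.z1 - Q2 * c.d2 * c.d4 - Q2 * c.d2 * c.g5 - Q3 * c.d2 + c.b5 * c.c3 + c.c5 *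
       c.f1 = 0) ∧
    (-Q1 ^ 2 * c.b2 * c.c3 - Q1 * Q2 * c.f2 * c.g3 = 0 ∧
     -Q1 * c.b2 * c.c4 - Q1 * c.b4 * c.d1 - Q2 * c.f2 * c.f4 - Q2 * c.f2 * c.g4 - Q3 * c.f2 + c.b4
       * c.z1 = 0) ∧
    -Q2 * c.d1 * c.g2 * q - Q1 * c.c2 * c.f2 - Q2 * c.g1 * c.g2 + c.d1 * c.f2 * q + c.b2 * c.d2 =
      0 := by
  have left_a (f g : A →ₗ[𝕜] 𝕜) := congrArg (fun x => pairing f g (H.braiding (x ⊗ₜ a))) hF.a_mul_s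
  have right_a (f g : A →ₗ[𝕜] 𝕜) := congrArg (fun x => pairing f g (H.braiding (a ⊗ₜ x))) hF.a_mul_s
  have left_K (f g : A →ₗ[𝕜] 𝕜) := congrArg (fun x => pairing f g (H.braiding (x ⊗ₜ K))) hF.a_mul_s
  simp only [TensorProduct.add_tmul, TensorProduct.tmul_add, ← TensorProduct.smul_tmul',
    TensorProduct.tmul_smul, map_add, map_smul, H.braiding_mul_tmul, H.braiding_tmul_mul,
    hc.braiding_rules, onFirst_tmul, onLast_tmul, mulFirst_tmul, mulLast_tmul,
    TensorProduct.assoc_tmul, pairing_tmul, smul_eq_mul, one_mul, mul_one] at left_a right_a left_K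
  simp only [hF.mul_rules, map_add, map_smul, smul_eq_mul] at left_a right_a left_K
  have e1 := left_a (coeff φ 0 0 1) (coeff φ 1 0 1)
  have e2 := left_a (coeff φ 0 0 1) (coeff φ 0 2 0)
  have e3 := left_a (coeff φ 0 0 1) (coeff φ 0 1 0)
  have e4 := left_a (coeff φ 0 1 0) (coeff φ 0 0 1)
  have e5 := right_a (coeff φ 1 0 1) (coeff φ 0 0 1)
  have e6 := right_a (coeff φ 0 0 1) (coeff φ 0 1 0)
  have e7 := left_K (coeff φ 0 0 1) (coeff φ 1 1 0)
  simp +decide only [hF.coeff_rules, reduceIte] at e1 e2 e3 e4 e5 e6 e7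
  exact ⟨⟨by linear_combination e1, by linear_combination e2, by linear_combination e3, by
    linear_combination e4⟩, ⟨by linear_combination e5, by linear_combination e6⟩, by
    linear_combination e7⟩

/-- The comultiplication after the first reduction: `a` and `a*` are primitive, and `q^N - e₁` is
primitive up to multiples of `a ⊗ a*` and `a* ⊗ a`. -/
structure HasPrimitiveComul (H : BraidedHopf 𝕜 A) (K a s : A) (c : Coeffs 𝕜) : Prop where
  comul_qN : H.comul K = c.A2 • (a ⊗ₜ[𝕜] s) + c.A3 • (s ⊗ₜ[𝕜] a) + 1 ⊗ₜ[𝕜] K + K ⊗ₜ[𝕜] 1 -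
    c.e1 • (1 ⊗ₜ[𝕜] 1)
  comul_a : H.comul a = 1 ⊗ₜ[𝕜] a + a ⊗ₜ[𝕜] 1
  comul_aStar : H.comul s = s ⊗ₜ[𝕜] 1 + 1 ⊗ₜ[𝕜] s

/-- Coefficients of `(id ⊗ Δ)ψ` and `(Δ ⊗ id)ψ` at `a ⊗ s`, and of the same maps at `s ⊗ a`. -/
lemma comul_braiding_a_aStar
    (hF : IsCoordinateMap q Q1 Q2 Q3 Q4 K a s φ) (hc : HasAnsatz H K a s c)
    (hR : HasPrimitiveComul H K a s c) :
    (c.A2 * c.b4 = 0 ∧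
     -c.b1 * c.e1 - c.b5 = 0 ∧
     -c.b4 * c.e1 - c.b6 = 0) ∧
    (c.A2 * c.b5 = 0 ∧
     -c.b1 * c.e1 - c.b4 = 0) ∧
    (c.A2 * c.c4 = 0 ∧
     -c.c1 * c.e1 - c.c5 = 0 ∧
     -c.c4 * c.e1 - c.c6 = 0) ∧
    (c.A2 * c.c5 = 0 ∧
     -c.c1 * c.e1 - c.c4 = 0) := by
  have last_as (f g h : A →ₗ[𝕜] 𝕜) :=
    congrArg (pairing f (pairing g h))
    (LinearMap.congr_fun H.comul_last_braiding (a ⊗ₜ s))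
  have first_as (f g h : A →ₗ[𝕜] 𝕜) :=
    congrArg (pairing f (pairing g h))
    (LinearMap.congr_fun H.comul_first_braiding (a ⊗ₜ s))
  have last_sa (f g h : A →ₗ[𝕜] 𝕜) :=
    congrArg (pairing f (pairing g h))
    (LinearMap.congr_fun H.comul_last_braiding (s ⊗ₜ a))
  have first_sa (f g h : A →ₗ[𝕜] 𝕜) :=
    congrArg (pairing f (pairing g h))
    (LinearMap.congr_fun H.comul_first_braiding (s ⊗ₜ a))
  simp only [LinearMap.comp_apply, comulFirst_tmul, comulLast_tmul, H.comul_one, hR.comul_qN,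
    hR.comul_a, hR.comul_aStar, TensorProduct.add_tmul, TensorProduct.tmul_add,
    TensorProduct.sub_tmul, TensorProduct.tmul_sub, ← TensorProduct.smul_tmul',
    TensorProduct.tmul_smul, map_add, map_sub, map_smul, hc.braiding_rules, onFirst_tmul,
    onLast_tmul, TensorProduct.assoc_tmul, pairing_tmul, smul_eq_mul]
    at last_as first_as last_sa first_sa
  have e1 := last_as (coeff φ 0 0 0) (coeff φ 0 0 1) (coeff φ 1 0 0)
  have e2 := last_as (coeff φ 0 1 0) (coeff φ 0 0 0) (coeff φ 0 0 0)
  have e3 := last_as (coeff φ 0 0 0) (coeff φ 0 0 0) (coeff φ 0 0 0)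
  have e4 := first_as (coeff φ 0 0 1) (coeff φ 1 0 0) (coeff φ 0 0 0)
  have e5 := first_as (coeff φ 0 0 0) (coeff φ 0 0 0) (coeff φ 0 1 0)
  have e6 := last_sa (coeff φ 0 0 0) (coeff φ 0 0 1) (coeff φ 1 0 0)
  have e7 := last_sa (coeff φ 0 1 0) (coeff φ 0 0 0) (coeff φ 0 0 0)
  have e8 := last_sa (coeff φ 0 0 0) (coeff φ 0 0 0) (coeff φ 0 0 0)
  have e9 := first_sa (coeff φ 0 0 1) (coeff φ 1 0 0) (coeff φ 0 0 0)
  have e10 := first_sa (coeff φ 0 0 0) (coeff φ 0 0 0) (coeff φ 0 1 0)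
  simp +decide only [hF.coeff_rules, reduceIte] at e1 e2 e3 e4 e5 e6 e7 e8 e9 e10
  exact ⟨⟨by linear_combination e1, by linear_combination e2, by linear_combination e3⟩, ⟨by
    linear_combination e4, by linear_combination e5⟩, ⟨by linear_combination e6, by
    linear_combination e7, by linear_combination e8⟩, ⟨by linear_combination e9, by
    linear_combination e10⟩⟩

/-- Coefficients of `(Δ ⊗ id)ψ` at `K ⊗ a` and `K ⊗ s`, of `(id ⊗ Δ)ψ` at `K ⊗ a`, `K ⊗ s` and
`K ⊗ K`, and of `(Δ ⊗ id)ψ` at `K ⊗ K`. -/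
lemma comul_braiding_qN
    (hF : IsCoordinateMap q Q1 Q2 Q3 Q4 K a s φ) (hc : HasAnsatz H K a s c)
    (hR : HasPrimitiveComul H K a s c) :
    (c.A2 * c.d2 = 0 ∧
     -c.d2 * c.e1 - c.d3 = 0) ∧
    (c.A2 * c.f2 = 0 ∧
     -c.e1 * c.f2 - c.f3 = 0) ∧
    (-c.A2 * c.c2 * c.z1 + c.A2 * c.d1 = 0 ∧
     -c.A2 * c.c5 * c.f3 - c.d1 * c.e1 - c.d4 + c.e1 = 0) ∧
    -c.A3 * c.b5 * c.d3 - c.e1 * c.f1 + c.e1 - c.f4 = 0 ∧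
    (-c.A2 * c.b5 * c.d3 - c.A3 * c.c5 * c.f3 - c.e1 * c.g1 + c.e1 - c.g5 = 0 ∧
     -c.A2 * c.b6 * c.d3 - c.A3 * c.c6 * c.f3 - c.e1 * c.g4 - c.g6 = 0) ∧
    -c.A2 * c.b4 * c.d3 - c.A3 * c.c4 * c.f3 - c.e1 * c.g1 + c.e1 - c.g4 = 0 := by
  have first_Ka (f g h : A →ₗ[𝕜] 𝕜) :=
    congrArg (pairing f (pairing g h))
    (LinearMap.congr_fun H.comul_first_braiding (K ⊗ₜ a))
  have first_Ks (f g h : A →ₗ[𝕜] 𝕜) :=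
    congrArg (pairing f (pairing g h))
    (LinearMap.congr_fun H.comul_first_braiding (K ⊗ₜ s))
  have last_Ka (f g h : A →ₗ[𝕜] 𝕜) :=
    congrArg (pairing f (pairing g h))
    (LinearMap.congr_fun H.comul_last_braiding (K ⊗ₜ a))
  have last_Ks (f g h : A →ₗ[𝕜] 𝕜) :=
    congrArg (pairing f (pairing g h))
    (LinearMap.congr_fun H.comul_last_braiding (K ⊗ₜ s))
  have last_KK (f g h : A →ₗ[𝕜] 𝕜) :=
    congrArg (pairing f (pairing g h))
    (LinearMap.congr_fun H.comul_last_braiding (K ⊗ₜ K))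
  have first_KK (f g h : A →ₗ[𝕜] 𝕜) :=
    congrArg (pairing f (pairing g h))
    (LinearMap.congr_fun H.comul_first_braiding (K ⊗ₜ K))
  simp only [LinearMap.comp_apply, comulFirst_tmul, comulLast_tmul, H.comul_one, hR.comul_qN,
    hR.comul_a, hR.comul_aStar, TensorProduct.add_tmul, TensorProduct.tmul_add,
    TensorProduct.sub_tmul, TensorProduct.tmul_sub, ← TensorProduct.smul_tmul',
    TensorProduct.tmul_smul, map_add, map_sub, map_smul, hc.braiding_rules, onFirst_tmul,
    onLast_tmul, TensorProduct.assoc_tmul, pairing_tmul, smul_eq_mul]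
    at first_Ka first_Ks last_Ka last_Ks last_KK first_KK
  have e1 := first_Ka (coeff φ 0 0 1) (coeff φ 1 0 0) (coeff φ 0 0 1)
  have e2 := first_Ka (coeff φ 0 0 0) (coeff φ 0 0 0) (coeff φ 0 0 1)
  have e3 := first_Ks (coeff φ 0 0 1) (coeff φ 1 0 0) (coeff φ 1 0 0)
  have e4 := first_Ks (coeff φ 0 0 0) (coeff φ 0 0 0) (coeff φ 1 0 0)
  have e5 := last_Ka (coeff φ 0 0 1) (coeff φ 0 0 1) (coeff φ 1 0 0)
  have e6 := last_Ka (coeff φ 0 0 1) (coeff φ 0 0 0) (coeff φ 0 0 0)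
  have e7 := last_Ks (coeff φ 1 0 0) (coeff φ 0 0 0) (coeff φ 0 0 0)
  have e8 := last_KK (coeff φ 0 1 0) (coeff φ 0 0 0) (coeff φ 0 0 0)
  have e9 := last_KK (coeff φ 0 0 0) (coeff φ 0 0 0) (coeff φ 0 0 0)
  have e10 := first_KK (coeff φ 0 0 0) (coeff φ 0 0 0) (coeff φ 0 1 0)
  simp +decide only [hF.coeff_rules, reduceIte] at e1 e2 e3 e4 e5 e6 e7 e8 e9 e10
  exact ⟨⟨by linear_combination e1, by linear_combination e2⟩, ⟨by linear_combination e3, by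
    linear_combination e4⟩, ⟨by linear_combination e5, by linear_combination e6⟩, by
    linear_combination e7, ⟨by linear_combination e8, by linear_combination e9⟩, by
    linear_combination e10⟩

/-- Coefficients of `Δ(aK) = q Δ(Ka)`. -/
lemma comul_a_qN_relation
    (hF : IsCoordinateMap q Q1 Q2 Q3 Q4 K a s φ) (hc : HasAnsatz H K a s c)
    (hR : HasPrimitiveComul H K a s c) :
    -c.A2 * c.c2 * q + c.A2 = 0 ∧
    c.A2 * Q3 * c.z1 - c.A2 * c.c4 * q - c.d1 * q + c.f2 + 1 = 0 ∧
    c.A2 * Q1 * c.z1 - c.A2 * q + c.A3 * c.b2 = 0 ∧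
    -c.A2 * Q1 * c.c3 * q - c.A3 * q * c.z1 + c.A3 * Q1 = 0 ∧
    -c.A2 * Q3 * c.c3 * q + c.A3 * Q3 + c.A3 * c.b5 - c.d2 * q + c.f1 - q = 0 ∧
    c.A3 * c.b3 - c.A3 * q = 0 := by
  have key (f g : A →ₗ[𝕜] 𝕜) := congrArg (fun x => pairing f g (H.comul x)) hF.a_mul_K
  simp only [H.comul_mul_apply, hR.comul_qN, hR.comul_a, TensorProduct.add_tmul,
    TensorProduct.tmul_add, TensorProduct.sub_tmul, TensorProduct.tmul_sub, ←
    TensorProduct.smul_tmul', TensorProduct.tmul_smul, map_add, map_sub, map_smul,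
    hc.braiding_rules, onMiddle_tmul, TensorProduct.assoc_tmul, TensorProduct.assoc_symm_tmul,
    TensorProduct.map_tmul, LinearMap.mul'_apply, pairing_tmul, smul_eq_mul, one_mul, mul_one]
    at key
  simp only [hF.mul_rules, map_add, map_smul, smul_eq_mul] at key
  have e1 := key (coeff φ 0 0 2) (coeff φ 1 0 0)
  have e2 := key (coeff φ 0 0 1) (coeff φ 0 1 0)
  have e3 := key (coeff φ 0 0 1) (coeff φ 1 0 1)
  have e4 := key (coeff φ 1 0 1) (coeff φ 0 0 1)
  have e5 := key (coeff φ 0 1 0) (coeff φ 0 0 1)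
  have e6 := key (coeff φ 1 0 0) (coeff φ 0 0 2)
  simp +decide only [hF.coeff_rules, reduceIte] at e1 e2 e3 e4 e5 e6
  exact ⟨by linear_combination e1, by linear_combination e2, by linear_combination e3, by
    linear_combination e4, by linear_combination e5, by linear_combination e6⟩

/-- Coefficients of `Δ` applied to the relation for `as`, when `K - e₁` is primitive. -/
lemma comul_a_aStar_relation
    (hF : IsCoordinateMap q Q1 Q2 Q3 Q4 K a s φ) (hc : HasAnsatz H K a s c)
    (hR : HasPrimitiveComul H K a s c) (hA2 : c.A2 = 0) (hA3 : c.A3 = 0) :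
    -Q1 * c.c1 - Q2 * c.g1 - Q2 + c.b1 = 0 ∧
    -Q1 * c.c2 - Q2 * c.g2 + c.b2 + 1 = 0 ∧
    -Q1 * c.c3 - Q2 * c.g3 - Q1 + c.b3 = 0 := by
  have key (f g : A →ₗ[𝕜] 𝕜) := congrArg (fun x => pairing f g (H.comul x)) hF.a_mul_s
  simp only [H.comul_mul_apply, H.comul_one, hR.comul_qN, hR.comul_a, hR.comul_aStar, hA2, hA3,
    zero_smul, zero_add, TensorProduct.add_tmul, TensorProduct.tmul_add, TensorProduct.sub_tmul,
    TensorProduct.tmul_sub, ← TensorProduct.smul_tmul', TensorProduct.tmul_smul, map_add, map_sub,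
    map_smul, hc.braiding_rules, onMiddle_tmul, TensorProduct.assoc_tmul,
    TensorProduct.assoc_symm_tmul, TensorProduct.map_tmul, LinearMap.mul'_apply, pairing_tmul,
    smul_eq_mul, one_mul, mul_one] at key
  simp only [hF.mul_rules, map_add, map_smul, smul_eq_mul] at key
  have e1 := key (coeff φ 0 1 0) (coeff φ 0 1 0)
  have e2 := key (coeff φ 0 0 1) (coeff φ 1 0 0)
  have e3 := key (coeff φ 1 0 0) (coeff φ 0 0 1)
  simp +decide only [hF.coeff_rules, reduceIte] at e1 e2 e3
  exact ⟨by linear_combination e1, by linear_combination e2, by linear_combination e3⟩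

end CoefficientEquations

/-! ### Solving for the constants -/

section Constants

variable {𝕜 A : Type*} [Field 𝕜] [Ring A] [Algebra 𝕜 A] {q Q1 Q2 Q3 Q4 : 𝕜} {K a s : A}
  {φ : A →ₗ[𝕜] (ℕ × ℕ × ℕ →₀ 𝕜)} {H : BraidedHopf 𝕜 A} {c : Coeffs 𝕜}

lemma e2_eq_zero (hF : IsCoordinateMap q Q1 Q2 Q3 Q4 K a s φ) (hc : HasAnsatz H K a s c) :
    c.e2 = 0 := by
  obtain ⟨-, -, h, h1, -, h3⟩ := counit_comul hF hc
  linear_combination c.e1 * h1 + h3 - c.e2 * h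

/-- If `A₂` or `A₃` is nonzero, coassociativity forces `A₁ = B₁ = B₂ = 0`. If both vanish and
`A₁ ≠ 0`, then `1 + A₁ (K - e₁)` is a group-like element of degree one in `K`; its inverse would have
to be its antipode, which has degree at most one as well, and this is impossible. -/
lemma A1_B1_B2_eq_zero (hF : IsCoordinateMap q Q1 Q2 Q3 Q4 K a s φ) (hc : HasAnsatz H K a s c) :
    c.A1 = 0 ∧ c.B1 = 0 ∧ c.B2 = 0 := by
  obtain ⟨⟨hA2, hA3⟩, h1, h2, h4, h5⟩ := coassoc_coeff hF hc
  have hA1 : c.A1 = 0 := by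
    by_cases h : c.A2 = 0
    · by_cases h' : c.A3 = 0
      · obtain ⟨⟨u3, -⟩, ⟨u1, u2⟩, -⟩ := counit_comul hF hc
        obtain ⟨⟨v1, -, v2, v3, -⟩, -⟩ := mul_antipode_coeff hF hc
        rw [h] at v1 v2 v3
        by_contra hA1
        have hk1 : c.k1 = 0 := by
          apply mul_left_cancel₀ hA1
          linear_combination v2
        rw [hk1] at v1
        have hA45 : c.A4 = c.A5 := by linear_combination u3 - u1
        apply one_ne_zero (α := 𝕜)
        linear_combination -c.A1 * v3 + c.A1 * u2 + c.A4 * v1 - (c.A4 + 1) * u1 - hA45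
      · have hB2 : c.B2 = 0 := by
          apply mul_left_cancel₀ h'
          linear_combination -h2 + c.B1 * h
        apply mul_left_cancel₀ h'
        linear_combination hA3 + c.A3 * hB2
    · have hB2 : c.B2 = 0 := by
        apply mul_left_cancel₀ h
        linear_combination -h4
      have hB1 : c.B1 = 0 := by
        apply mul_left_cancel₀ h
        linear_combination h2 + c.A3 * hB2
      apply mul_left_cancel₀ h
      linear_combination hA2 + c.A2 * hB1
  refine ⟨hA1, ?_, ?_⟩
  · apply pow_eq_zero_iff (two_ne_zero) |>.1
    linear_combination -h1 + c.B1 * hA1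
  · apply pow_eq_zero_iff (two_ne_zero) |>.1
    linear_combination h5 + c.B2 * hA1

lemma comul_constants (hF : IsCoordinateMap q Q1 Q2 Q3 Q4 K a s φ) (hc : HasAnsatz H K a s c) :
    c.A4 = 1 ∧ c.A5 = 1 ∧ c.A6 = -c.e1 ∧ c.B3 = 1 ∧ c.B4 = 1 := by
  obtain ⟨hA1, hB1, hB2⟩ := A1_B1_B2_eq_zero hF hc
  obtain ⟨⟨u1, u2⟩, ⟨u3, -⟩, u4, -, u5, -⟩ := counit_comul hF hc
  rw [hA1] at u1 u3
  rw [hB1] at u4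
  rw [hB2] at u5
  refine ⟨?_, ?_, ?_, ?_, ?_⟩
  · linear_combination u1
  · linear_combination u3
  · linear_combination u2 - c.e1 * u3
  · linear_combination u4
  · linear_combination u5

lemma hasPrimitiveComul (hF : IsCoordinateMap q Q1 Q2 Q3 Q4 K a s φ) (hc : HasAnsatz H K a s c) :
    HasPrimitiveComul H K a s c := by
  obtain ⟨hA1, hB1, hB2⟩ := A1_B1_B2_eq_zero hF hc
  obtain ⟨hA4, hA5, hA6, hB3, hB4⟩ := comul_constants hF hc
  constructor
  · rw [hc.comul_qN, hA1, hA4, hA5, hA6]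
    module
  · rw [hc.comul_a, hB1, hB2, hB3, hB4]
    module
  · rw [hc.comul_aStar, hB1, hB2, hB3, hB4]
    module

/-- The antipode is determined by the comultiplication. The last two equations come from the
coefficients of `sa` and `K²` in `m(id ⊗ S)Δ(K) = e₁`, where `as` has to be put in normal order. -/
lemma antipode_constants (hF : IsCoordinateMap q Q1 Q2 Q3 Q4 K a s φ) (hc : HasAnsatz H K a s c) :
    (c.m1 = 0 ∧ c.m2 = -1 ∧ c.m3 = 0 ∧ c.m4 = 0) ∧
    (c.k2 = 0 ∧ c.k3 = 0 ∧ c.k4 = 2 * c.e1 + c.A2 * Q4) ∧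
    c.A3 = -(c.A2 * Q1) ∧ c.A2 * Q2 = 0 := by
  obtain ⟨hA1, hB1, hB2⟩ := A1_B1_B2_eq_zero hF hc
  obtain ⟨hA4, hA5, hA6, hB3, hB4⟩ := comul_constants hF hc
  obtain ⟨⟨-, v1, v2, v3, v4, v5⟩, w1, w2, w3, w4⟩ := mul_antipode_coeff hF hc
  simp only [hB1, hB2, hB3, hB4, e2_eq_zero hF hc, zero_mul, one_mul, zero_add, sub_zero]
    at w1 w2 w3 w4
  have hm2 : c.m2 = -1 := by linear_combination w3
  simp only [hA1, hA4, hA6, hm2, w4] at v1 v2 v3 v4 v5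
  refine ⟨⟨w1, hm2, w2, w4⟩, ⟨?_, ?_, ?_⟩, ?_, ?_⟩
  · linear_combination v5
  · linear_combination v4
  · linear_combination v3
  · linear_combination -v1
  · linear_combination -v2

/-- The counit applied to the relation for `as`. -/
lemma counit_relation (hF : IsCoordinateMap q Q1 Q2 Q3 Q4 K a s φ) (hc : HasAnsatz H K a s c) :
    Q2 * c.e1 ^ 2 + Q3 * c.e1 + Q4 = 0 := by
  have h := congrArg H.counit hF.a_mul_s
  simp only [map_add, map_smul, H.counit_mul_apply, hc.counit_qN, hc.counit_a, hc.counit_aStar,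
    counit_one hF, e2_eq_zero hF hc, smul_eq_mul] at h
  linear_combination -h

lemma braiding_a_aStar_constants (hF : IsCoordinateMap q Q1 Q2 Q3 Q4 K a s φ)
    (hc : HasAnsatz H K a s c) :
    c.b4 = -(c.b1 * c.e1) ∧ c.b5 = -(c.b1 * c.e1) ∧ c.b6 = c.b1 * c.e1 ^ 2 ∧
    c.c4 = -(c.c1 * c.e1) ∧ c.c5 = -(c.c1 * c.e1) ∧ c.c6 = c.c1 * c.e1 ^ 2 := by
  obtain ⟨⟨-, b5, b6⟩, ⟨-, b4⟩, ⟨-, c5, c6⟩, -, c4⟩ :=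
    comul_braiding_a_aStar hF hc (hasPrimitiveComul hF hc)
  refine ⟨?_, ?_, ?_, ?_, ?_, ?_⟩
  · linear_combination -b4
  · linear_combination -b5
  · linear_combination -b6 + c.e1 * b4
  · linear_combination -c4
  · linear_combination -c5
  · linear_combination -c6 + c.e1 * c4

lemma braiding_qN_constants (hF : IsCoordinateMap q Q1 Q2 Q3 Q4 K a s φ) (hc : HasAnsatz H K a s c) :
    (c.d3 = -(c.d2 * c.e1) ∧ c.d4 = c.e1 * (1 - c.d1) ∧
      c.f3 = -(c.f2 * c.e1) ∧ c.f4 = c.e1 * (1 - c.f1)) ∧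
    c.g4 = c.e1 * (1 - c.g1) ∧ c.g5 = c.e1 * (1 - c.g1) ∧ c.g6 = -(c.e1 ^ 2 * (1 - c.g1)) := by
  have hR := hasPrimitiveComul hF hc
  obtain ⟨-, -, hA3, -⟩ := antipode_constants hF hc
  obtain ⟨⟨hb4, -, b6⟩, ⟨hb5, -⟩, ⟨hc4, -, c6⟩, hc5, -⟩ :=
    comul_braiding_a_aStar hF hc hR
  obtain ⟨⟨-, d3⟩, ⟨-, f3⟩, ⟨-, d4⟩, f4, ⟨g5, g6⟩, g4⟩ := comul_braiding_qN hF hc hR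
  rw [hA3] at f4 g4 g5 g6
  have hg4 : c.g4 = c.e1 * (1 - c.g1) := by
    linear_combination -g4 - c.d3 * hb4 + Q1 * c.f3 * hc4
  have hb6 : c.A2 * c.b6 = 0 := by linear_combination -c.A2 * b6 - c.e1 * hb4
  have hc6 : c.A2 * c.c6 = 0 := by linear_combination -c.A2 * c6 - c.e1 * hc4
  refine ⟨⟨?_, ?_, ?_, ?_⟩, hg4, ?_, ?_⟩
  · linear_combination -d3
  · linear_combination -d4 - c.f3 * hc5
  · linear_combination -f3
  · linear_combination -f4 + Q1 * c.d3 * hb5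
  · linear_combination -g5 - c.d3 * hb5 + Q1 * c.f3 * hc5
  · linear_combination -g6 - c.d3 * hb6 + Q1 * c.f3 * hc6 - c.e1 * hg4

/-- If `A₂ ≠ 0` and `e₁ ≠ 0`, the axioms force `f₁ = q²` and `b₃ = q`, while the braiding of `aK` with
`s` forces `f₁ = 1`; this contradicts `q ≠ ±1`. -/
lemma e1_eq_zero_of_A2_ne_zero (hq : q ≠ 1) (hq' : q ≠ -1)
    (hF : IsCoordinateMap q Q1 Q2 Q3 Q4 K a s φ) (hc : HasAnsatz H K a s c) (hA2 : c.A2 ≠ 0) :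
    c.e1 = 0 := by
  have hR := hasPrimitiveComul hF hc
  obtain ⟨-, -, hA3, -⟩ := antipode_constants hF hc
  obtain ⟨⟨-, hd4, -, hf4⟩, -⟩ := braiding_qN_constants hF hc
  obtain ⟨-, ⟨hb5, -⟩, ⟨hc4, -⟩, -⟩ := comul_braiding_a_aStar hF hc hR
  obtain ⟨⟨hd2, -⟩, ⟨hf2, -⟩, ⟨hd1, -⟩, -⟩ := comul_braiding_qN hF hc hR
  replace hb5 : c.b5 = 0 := (mul_eq_zero.1 hb5).resolve_left hA2
  replace hc4 : c.c4 = 0 := (mul_eq_zero.1 hc4).resolve_left hA2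
  replace hd2 : c.d2 = 0 := (mul_eq_zero.1 hd2).resolve_left hA2
  replace hf2 : c.f2 = 0 := (mul_eq_zero.1 hf2).resolve_left hA2
  obtain ⟨h1, h2, h3, h4, h5, h6⟩ := comul_a_qN_relation hF hc hR
  replace hd1 : c.d1 = c.c2 * c.z1 := by
    apply mul_left_cancel₀ hA2
    linear_combination hd1
  obtain ⟨-, -, ⟨hs, -⟩, ⟨ht, -⟩, -⟩ := braiding_a_qN_relation hF hc
  have hc2 : c.c2 * q = 1 := by
    apply mul_left_cancel₀ hA2
    linear_combination -h1
  have hq0 : q ≠ 0 := right_ne_zero_of_mul_eq_one hc2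
  have hc20 : c.c2 ≠ 0 := left_ne_zero_of_mul_eq_one hc2
  have hq1 : 1 - q ≠ 0 := sub_ne_zero.2 hq.symm
  by_contra he
  have hd1' : c.d1 = 1 := by
    rw [hc4, hd4] at ht
    have : c.c2 * c.e1 * (1 - q) * (1 - c.d1) = 0 := by linear_combination ht
    have := (mul_eq_zero.1 this).resolve_left (by simp [hc20, he, hq1])
    linear_combination -this
  have hz1 : c.z1 = q := by
    apply mul_left_cancel₀ hc20
    linear_combination hd1' - hd1 - hc2
  rw [hc4, hd1', hf2, hz1] at h2
  have hQ1 : Q1 ≠ 0 := by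
    rintro rfl
    rw [hA3, hz1] at h3
    refine mul_ne_zero hA2 hq0 ?_
    linear_combination -h3
  have hAQ : c.A2 * Q1 ≠ 0 := mul_ne_zero hA2 hQ1
  have hc3 : c.c3 * q + Q1 = q ^ 2 := by
    apply mul_left_cancel₀ hAQ
    rw [hA3, hz1] at h4
    linear_combination -h4
  have hf1 : c.f1 = q ^ 2 := by
    rw [hA3, hb5, hd2] at h5
    linear_combination h5 + c.A2 * Q3 * hc3 + q * h2
  have hb3 : c.b3 = q := by
    apply mul_left_cancel₀ hAQ
    rw [hA3] at h6
    linear_combination -h6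
  rw [hb5, hb3, hf4, hf1] at hs
  have : q * c.e1 * (1 - q) * ((1 - q) * (1 + q)) = 0 := by linear_combination hs
  have hq2 : 1 + q ≠ 0 := fun h => hq' (by linear_combination h)
  exact mul_ne_zero (mul_ne_zero (mul_ne_zero hq0 he) hq1) (mul_ne_zero hq1 hq2) this

/-- If `A₂ = 0`, then `K - e₁` is primitive and satisfies
`a (K - e₁) = q (K - e₁) a + (q - 1) e₁ a`. The braidings of the inhomogeneous term `(q - 1) e₁ a`
have to match separately, which is impossible when `e₁ ≠ 0`. -/
lemma e1_eq_zero_of_A2_eq_zero [CharZero 𝕜] (hq : q ≠ 1)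
    (hF : IsCoordinateMap q Q1 Q2 Q3 Q4 K a s φ) (hc : HasAnsatz H K a s c) (hA2 : c.A2 = 0) :
    c.e1 = 0 := by
  have hR := hasPrimitiveComul hF hc
  have hA3 : c.A3 = 0 := by
    rw [(antipode_constants hF hc).2.2.1, hA2, zero_mul, neg_zero]
  obtain ⟨-, hf2, -, -, hf1, -⟩ := comul_a_qN_relation hF hc hR
  obtain ⟨hb1, hb2, hb3⟩ := comul_a_aStar_relation hF hc hR hA2 hA3
  obtain ⟨⟨p1, p2, p3⟩, ⟨r1, r2⟩, ⟨s1, s2, s3, s4, s5⟩, ⟨t1, t2⟩, ⟨k1, k2, k3⟩, u1, u2⟩ :=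
    braiding_a_qN_relation hF hc
  obtain ⟨-, hb5, -, hc4, -, -⟩ := braiding_a_aStar_constants hF hc
  obtain ⟨⟨hd3, hd4, hf3, hf4⟩, hg4, hg5, -⟩ := braiding_qN_constants hF hc
  rw [hA2, hA3] at hf1
  rw [hA2] at hf2
  rw [hd4, hf3] at p1
  rw [hd3, hf4] at r1
  rw [hf3, hg5, hb5] at k1
  rw [hf3, hg5, hd4] at k3
  rw [hc4, hd4] at t1
  rw [hc4, hg4, hd3] at u1
  rw [hf4, hb5] at s1
  rw [hd4, hb5, hf4, hf3] at s5
  replace hf2 : c.f2 = c.d1 * q - 1 := by linear_combination hf2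
  replace hf1 : c.f1 = c.d2 * q + q := by linear_combination hf1
  have hq1 : 1 - q ≠ 0 := sub_ne_zero.2 hq.symm
  by_contra he
  have heq : c.e1 * (1 - q) ≠ 0 := mul_ne_zero he hq1
  have hd1 : c.z1 * (1 - c.d1) = 0 := by
    apply mul_left_cancel₀ heq
    linear_combination p1 + c.e1 * p3
  have hf1' : c.z1 * (1 - c.f1) = 0 := by
    apply mul_left_cancel₀ heq
    linear_combination r1 - c.e1 * q * p3
  -- If `z₁ ≠ 0`, then `d₁ = f₁ = 1`, so `f₂ = q - 1` and `q d₂ = 1 - q`, against `d₂ f₂ = 0`.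
  have hz1 : c.z1 = 0 := by
    by_contra hz
    have h1 : 1 - c.d1 = 0 := (mul_eq_zero.1 hd1).resolve_left hz
    have h2 : 1 - c.f1 = 0 := (mul_eq_zero.1 hf1').resolve_left hz
    have h3 : (1 - q) * (1 - q) = 0 := by
      linear_combination (1 - q) * (hf1 + h2) - q * p3 + c.d2 * q * hf2 - c.d2 * q ^ 2 * h1
    exact mul_ne_zero hq1 hq1 h3
  rw [hz1] at p2 r2 k3
  have hb1g3 : c.b1 * c.g3 = 0 := by linear_combination k2 + q ^ 2 * p3
  have hfg : c.f1 * (1 - c.g1) = 0 := by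
    apply mul_left_cancel₀ heq
    linear_combination k1 + c.e1 * hb1g3 - c.e1 * q * p3
  have hcd : c.c2 * (1 - c.d1) = 0 := by
    apply mul_left_cancel₀ heq
    linear_combination t1 + c.e1 * t2
  have hdg : c.d1 * (1 - c.g1) = 0 := by
    apply mul_left_cancel₀ heq
    linear_combination u1 + c.e1 * p3 - c.e1 * q * t2
  have hb3' : c.b3 = 0 := by
    have h : c.b3 * (1 - c.f1) = 0 := by
      apply mul_left_cancel₀ heq
      linear_combination s1 - c.e1 * q * hb1g3
    refine (mul_eq_zero.1 h).resolve_right fun h1 => hq1 ?_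
    linear_combination h1 + hf1 + q * c.d2 * h1 + q * p2
  rw [hb3'] at s2 hb3
  by_cases hq0 : q = 0
  -- For `q = 0` the constants are forced to `b₂ = 1`, `Q₁ = 0`, `Q₂ g₂ = 2`, and then `g₁ = d₁ = 0`.
  · subst hq0
    have hf2' : c.f2 = -1 := by linear_combination hf2
    have hf1' : c.f1 = 0 := by linear_combination hf1
    have hd2 : c.d2 = 0 := by linear_combination -p3 + c.d2 * hf2'
    have hb2' : c.b2 = 1 := by
      apply mul_left_cancel₀ he
      rw [hf2', hf1'] at s5
      linear_combination s5
    obtain ⟨⟨v1, -⟩, ⟨v2, -⟩, v3⟩ := braiding_a_aStar_relation hF hc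
    rw [hd2, hb2'] at v1
    have hc3 : c.c3 = 0 := by linear_combination v1
    rw [hc3] at hb3
    rw [hc3, hf2'] at v2
    have hQ1 : Q1 = 0 := by
      apply pow_eq_zero_iff (two_ne_zero) |>.1
      linear_combination -v2 - Q1 * hb3
    rw [hQ1, hb2'] at hb2
    have hg2 : Q2 * c.g2 = 2 := by linear_combination -hb2
    have hg2' : c.g2 ≠ 0 := right_ne_zero_of_mul (hg2 ▸ two_ne_zero)
    have hd1 : c.d1 = 0 := by
      apply mul_left_cancel₀ hg2'
      linear_combination u2
    have hg1 : c.g1 = 0 := by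
      rw [hQ1, hd2] at v3
      apply mul_left_cancel₀ (two_ne_zero (α := 𝕜))
      linear_combination -v3 - c.g1 * hg2
    rw [hf2', hg1, hd1] at k3
    exact he (by linear_combination -k3)
  · have hfd : c.f2 * c.d1 = 0 := by
      apply mul_left_cancel₀ hq0
      linear_combination -r2
    -- For `q ≠ 0` either `d₁ q = 1` or `d₁ = 0`; in both cases the value of `b₂` is contradictory.
    rcases mul_eq_zero.1 hfd with h | h
    · have hd1q : c.d1 * q = 1 := by linear_combination h - hf2
      have hd10 : c.d1 ≠ 0 := left_ne_zero_of_mul_eq_one hd1q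
      have hc2 : c.c2 = 0 := by
        refine (mul_eq_zero.1 hcd).resolve_right fun h1 => hq1 ?_
        linear_combination -q * h1 - hd1q
      have hb2' : c.b2 = 0 := by
        apply mul_left_cancel₀ (mul_ne_zero (two_ne_zero (α := 𝕜)) heq)
        linear_combination s5 + c.e1 * s4 - c.e1 * c.b2 * (1 - q) * hd1q +
          (c.e1 - c.e1 * q) * c.f2 * h
      have hg2 : c.g2 = 0 := by
        apply mul_left_cancel₀ hd10
        linear_combination u2 + c.g2 * q * hc2
      apply one_ne_zero (α := 𝕜)
      linear_combination hb2 - hb2' + Q1 * hc2 + Q2 * hg2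
    · have hf2' : c.f2 = -1 := by linear_combination hf2 + q * h
      have hd2 : c.d2 = 0 := by linear_combination -p3 + c.d2 * hf2'
      have hf1' : c.f1 = q := by linear_combination hf1 + q * hd2
      have hg1 : c.g1 = 1 := by
        apply mul_left_cancel₀ hq0
        linear_combination -hfg + (1 - c.g1) * hf1'
      rw [hd2, hf2', hf1'] at s2 s3
      rw [hg1] at s3 hb1
      have hQ1 : Q1 = 0 := by
        apply mul_left_cancel₀ hq0
        linear_combination -s2
      have hQ2 : Q2 = 0 := by
        apply mul_left_cancel₀ hq0
        linear_combination -s3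
      rw [hQ1, hQ2] at hb1 hb2
      have hb1' : c.b1 = 0 := by linear_combination hb1
      have hb2' : c.b2 = -1 := by linear_combination hb2
      rw [hb1', hb2', h, hf1', hf2'] at s5
      refine mul_ne_zero (two_ne_zero (α := 𝕜)) heq ?_
      linear_combination -s5

/-- If `e₁ = 0` and `Q₂ Q₃ ≠ 0`, comparing the braidings of `as` and `Q₂ K² + Q₃ K` with `a` gives
`c₂ z₁ = d₁ = d₁²`, because `ψ` moves `a` past `K²` with the factor `d₁²`. Since `d₁ q = 1`, this
forces `q = 1`. -/
lemma Q2_eq_zero_or_Q3_eq_zero (hq : q ≠ 1)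
    (hF : IsCoordinateMap q Q1 Q2 Q3 Q4 K a s φ) (hc : HasAnsatz H K a s c) (he : c.e1 = 0) :
    Q2 = 0 ∨ Q3 = 0 := by
  by_contra! hQ
  obtain ⟨hQ2, hQ3⟩ := hQ
  have hR := hasPrimitiveComul hF hc
  obtain ⟨-, -, hA3, hA2⟩ := antipode_constants hF hc
  replace hA2 : c.A2 = 0 := (mul_eq_zero.1 hA2).resolve_right hQ2
  obtain ⟨-, hf2, -, -, -, -⟩ := comul_a_qN_relation hF hc hR
  obtain ⟨hb4, hb5, -, hc4, hc5, -⟩ := braiding_a_aStar_constants hF hc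
  obtain ⟨⟨-, hd4, hf3, hf4⟩, hg4, hg5, -⟩ := braiding_qN_constants hF hc
  obtain ⟨⟨-, h1, h2, -⟩, ⟨-, h4⟩, -⟩ := braiding_a_aStar_relation hF hc
  simp only [he, mul_zero, zero_mul, neg_zero] at hb4 hb5 hc4 hc5 hd4 hf3 hf4 hg4 hg5
  rw [hA2] at hf2
  rw [hd4, hf3, hc5] at h2
  rw [hc4, hb4, hf4, hg4] at h4
  have hf2' : c.f2 = 0 := by
    apply mul_left_cancel₀ hQ3
    linear_combination -h4
  have hd1q : c.d1 * q = 1 := by linear_combination hf2' - hf2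
  have h2' : c.c2 * c.z1 = c.d1 := by
    apply mul_left_cancel₀ hQ3
    linear_combination h2
  have h1' : c.c2 * c.z1 = c.d1 ^ 2 := by
    apply mul_left_cancel₀ hQ2
    linear_combination h1 - c.c1 * hf2'
  have hd1 : c.d1 = 1 := by
    apply mul_left_cancel₀ (left_ne_zero_of_mul_eq_one hd1q)
    linear_combination h2' - h1'
  apply hq
  linear_combination hd1q - q * hd1

end Constants

end BraidedOsc

theorem mainTheorem1 {𝕜 : Type*} [RCLike 𝕜] (q Q1 Q2 Q3 Q4 : ℝ)
    (hq_one : q ≠ 1) (hq_neg_one : q ≠ -1)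
    (H : BraidedOsc.BraidedHopf 𝕜 (BraidedOsc.Oscillator 𝕜 q Q1 Q2 Q3 Q4))
    (c : BraidedOsc.Coeffs 𝕜)
    (hc : BraidedOsc.HasAnsatz H
      (BraidedOsc.gen 𝕜 q Q1 Q2 Q3 Q4 BraidedOsc.Gen.qN)
      (BraidedOsc.gen 𝕜 q Q1 Q2 Q3 Q4 BraidedOsc.Gen.a)
      (BraidedOsc.gen 𝕜 q Q1 Q2 Q3 Q4 BraidedOsc.Gen.aStar) c) :
    (Q4 = 0 ∧ c.A1 = 0 ∧ c.A6 = 0 ∧ c.B1 = 0 ∧ c.B2 = 0 ∧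
      c.A4 = 1 ∧ c.A5 = 1 ∧ c.B3 = 1 ∧ c.B4 = 1) ∧
    (c.k2 = 0 ∧ c.k3 = 0 ∧ c.k4 = 0 ∧ c.m1 = 0 ∧ c.m3 = 0 ∧ c.m4 = 0 ∧
      c.e1 = 0 ∧ c.e2 = 0 ∧ c.m2 = -1) ∧
    (c.b4 = 0 ∧ c.b5 = 0 ∧ c.b6 = 0 ∧ c.c4 = 0 ∧ c.c5 = 0 ∧ c.c6 = 0 ∧
      c.g4 = 0 ∧ c.g5 = 0 ∧ c.g6 = 0 ∧ c.d3 = 0 ∧ c.d4 = 0 ∧ c.f3 = 0 ∧ c.f4 = 0) ∧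
    (Q2 = 0 ∨ Q3 = 0) := by
  obtain ⟨φ, hF⟩ := BraidedOsc.exists_isCoordinateMap 𝕜 q Q1 Q2 Q3 Q4
  have hq : (q : 𝕜) ≠ 1 := by exact_mod_cast hq_one
  have hq' : (q : 𝕜) ≠ -1 := by exact_mod_cast hq_neg_one
  have he : c.e1 = 0 := by
    by_cases hA2 : c.A2 = 0
    · exact BraidedOsc.e1_eq_zero_of_A2_eq_zero hq hF hc hA2
    · exact BraidedOsc.e1_eq_zero_of_A2_ne_zero hq hq' hF hc hA2
  have hQ4 : (Q4 : 𝕜) = 0 := by simpa [he] using BraidedOsc.counit_relation hF hc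
  obtain ⟨hA1, hB1, hB2⟩ := BraidedOsc.A1_B1_B2_eq_zero hF hc
  obtain ⟨hA4, hA5, hA6, hB3, hB4⟩ := BraidedOsc.comul_constants hF hc
  obtain ⟨⟨hm1, hm2, hm3, hm4⟩, ⟨hk2, hk3, hk4⟩, -⟩ := BraidedOsc.antipode_constants hF hc
  obtain ⟨hb4, hb5, hb6, hc4, hc5, hc6⟩ := BraidedOsc.braiding_a_aStar_constants hF hc
  obtain ⟨⟨hd3, hd4, hf3, hf4⟩, hg4, hg5, hg6⟩ := BraidedOsc.braiding_qN_constants hF hc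
  have hQ := BraidedOsc.Q2_eq_zero_or_Q3_eq_zero hq hF hc he
  simp only [he, hQ4, ne_eq, OfNat.ofNat_ne_zero, not_false_eq_true, zero_pow, mul_zero, zero_mul,
    neg_zero, add_zero] at hA6 hk4 hb4 hb5 hb6 hc4 hc5 hc6 hd3 hd4 hf3 hf4 hg4 hg5 hg6
  refine ⟨⟨by exact_mod_cast hQ4, hA1, hA6, hB1, hB2, hA4, hA5, hB3, hB4⟩,
    ⟨hk2, hk3, hk4, hm1, hm3, hm4, he, BraidedOsc.e2_eq_zero hF hc, hm2⟩,
    ⟨hb4, hb5, hb6, hc4, hc5, hc6, hg4, hg5, hg6, hd3, hd4, hf3, hf4⟩, by exact_mod_cast hQ⟩
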